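/- Let $\kappa \in \mathbb{R}$. Let $\mathbb{M}^2_\kappa$ be the complete, simply connected surface of constant curvature $\kappa$ and $D_\kappa$ its diameter, that is, $D_\kappa = \pi/\sqrt{\kappa}$ if $\kappa > 0$ and $D_\kappa = \infty$ if $\kappa \le 0$. In a metric space, write $|pq|$ for the distance of $p$ and $q$. A *segment* $pq$ is the image of an isometric embedding of $[0,|pq|]$ sending $0$ to $p$ and $|pq|$ to $q$. A *hinge* $H_p(x,y)$ consists of three points $p,x,y$ with $p \notin \{x,y\}$ and two segments $px$, $py$. The *perimeter* of $(p,x,y)$ is $|px|+|py|+|xy|$. A *comparison triple* for $(p,x,y)$ is a triple $(\bar p,\bar x,\bar y)$ in $\mathbb{M}^2_\kappa$ with $|\bar p\bar x| = |px|$, $|\bar p\bar y| = |py|$, $|\bar x\bar y| = |xy|$. If $p \notin \{x,y\}$, $|px|,|py| < D_\kappa$ and the perimeter of $(p,x,y)$ is at most $2D_\kappa$, then the *comparison angle* $\angle^\kappa_p(x,y) \in [0,\pi]$ is the angle at $\bar p$ between $\bar p\bar x$ and $\bar p\bar y$ for any comparison triple. The *angle* of a hinge $H_p(x,y)$ is $$\angle_p(x,y)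 := \limsup_{u \in px,\ v \in py,\ u,v \to p} \angle^\kappa_p(u,v), \qquad u,v \ne p.$$ For a hinge $H = H_p(x,y)$ of perimeter $< 2D_\kappa$ consider the following properties: - (A$_\kappa$) $\angle_p(x,y) \ge \angle^\kappa_p(x,y)$; - (H$_\kappa$) $|xy| \le |\hat x\hat y|$ for every hinge $H_{\hat p}(\hat x,\hat y)$ in $\mathbb{M}^2_\kappa$ with $|\hat p\hat x| = |px|$, $|\hat p\hat y| = |py|$ and hinge angle $\angle_{\hat p}(\hat x,\hat y) = \angle_p(x,y)$; - (D$_\kappa$) for every comparison triple $(\bar p,\bar x,\bar y)$ for $(p,x,y)$: $|uv| \ge |\bar u\bar v|$ whenever $u \in px$, $v \in py$, $\bar u \in \bar p\bar x$, $\bar v \in \bar p\bar y$, $|pu| = |\bar p\bar u|$ and $|pv| = |\bar p\bar v|$. A metric space $M$ has *curvature $\ge \kappa$ in the sense of Alexandrov* if every point $q \in M$ has a neighborhood $U_q$ such that any two points of $U_q$ are connected by a segment in $M$ and every hinge $H_p(x,y)$ in $M$ with $p,x,y \in U_q$ and perimeter $< 2D_\kappa$ satisfies (D$_\kappa$). **Theorem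 (Toponogov).** Let $M$ be a complete metric space of curvature $\ge \kappa$ in the sense of Alexandrov. Suppose that every pair of points in $M$ at distance $< D_\kappa$ is connected by a segment. Then every hinge $H_p(x,y)$ in $M$ with perimeter $< 2D_\kappa$ satisfies (A$_\kappa$), (H$_\kappa$) and (D$_\kappa$). -/

import Mathlib

open Set Filter Topology

noncomputable section

namespace Toponogov

/-- The two-dimensional complete simply connected model space of constant curvature `κ`, realized
in `ℝ × ℝ²` by the equation `t ^ 2 + κ * ‖v‖ ^ 2 = 1` (together with `0 < t` if `κ ≤ 0`).
For `κ > 0`, the map `(t, v) ↦ (t / √κ, v)` identifies it with the round sphere of radius `1 / √κ`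
in `ℝ³`; for `κ = 0` it is the plane `{1} × ℝ²`; for `κ < 0`, the map `(t, v) ↦ (t / √(-κ), v)`
identifies it with the upper sheet `‖v‖ ^ 2 - s ^ 2 = -1 / (-κ)`, `s > 0`, of the hyperboloid
in Minkowski space (hyperboloid model). -/
@[ext]
structure ModelPlane (κ : ℝ) where
  /-- the first ambient coordinate -/
  t : ℝ
  /-- the other two ambient coordinates -/
  v : EuclideanSpace ℝ (Fin 2)
  eq_one : t ^ 2 + κ * ‖v‖ ^ 2 = 1
  pos : κ ≤ 0 → 0 < t

namespace ModelPlane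

variable {κ : ℝ}

/-- The ambient bilinear form `t t' + κ ⟨v, v'⟩`; up to the factor `κ` it is the inner product of
`ℝ³` if `κ > 0`, and the Minkowski product if `κ < 0`. -/
def form (x y : ModelPlane κ) : ℝ := x.t * y.t + κ * inner ℝ x.v y.v

/-- The distance of the model plane: the great circle distance on the sphere of radius `1 / √κ`,
the Euclidean distance, or the distance of the hyperbolic plane of curvature `κ`. -/
instance : Dist (ModelPlane κ) where
  dist x y :=
    if 0 < κ then Real.arccos (form x y) / √κ
    else if κ = 0 then ‖x.v - y.v‖
    else Real.arcosh (form x y) / √(-κ)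

/-- The tangent vector `x - form p x • p` at `p` (an element of the ambient space `ℝ × ℝ²`).
It is a positive multiple of the initial vector of the segment from `p` to `x`, if `x ≠ p` and,
in the spherical case, `x` is not antipodal to `p`. -/
def dir (p x : ModelPlane κ) : ℝ × EuclideanSpace ℝ (Fin 2) :=
  (x.t - form p x * p.t, x.v - form p x • p.v)

/-- The ambient inner product that induces the Riemannian metric of the model plane, written in
the coordinates `(t, v)`: it is `⟨v, w⟩ + s t / κ`. If `κ = 0`, then tangent vectors have vanishing
first coordinate, and the second summand is zero. -/
def metricForm (κ : ℝ) (a b : ℝ × EuclideanSpace ℝ (Fin 2)) : ℝ :=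
  inner ℝ a.2 b.2 + a.1 * b.1 / κ

/-- The angle in `[0, π]` at the vertex `p` between the segments from `p` to `x` and from `p` to
`y` in the model plane, that is, the angle between their initial vectors. -/
def angle (p x y : ModelPlane κ) : ℝ :=
  Real.arccos (metricForm κ (dir p x) (dir p y) /
    (√(metricForm κ (dir p x) (dir p x)) * √(metricForm κ (dir p y) (dir p y))))

end ModelPlane

/-- The diameter `D_κ` of the model plane of curvature `κ`. -/
def modelDiam (κ : ℝ) : EReal :=
  if 0 < κ then ((Real.pi / √κ : ℝ) : EReal) else ⊤

/-- `s` is a segment connecting `p` and `q`: the image of an isometric embedding of the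
interval `[0, dist p q]` that maps `0` to `p` and `dist p q` to `q`. -/
def IsSegment {X : Type*} [Dist X] (p q : X) (s : Set X) : Prop :=
  ∃ γ : ℝ → X, γ 0 = p ∧ γ (dist p q) = q ∧
    (∀ a ∈ Icc 0 (dist p q), ∀ b ∈ Icc 0 (dist p q), dist (γ a) (γ b) = |a - b|) ∧
    s = γ '' Icc 0 (dist p q)

/-- The perimeter of a triple of points. -/
def perimeter {X : Type*} [Dist X] (p x y : X) : ℝ := dist p x + dist p y + dist x y

/-- A hinge: a vertex `p`, two endpoints `x`, `y`, and two nondegenerate segments `px`, `py`. -/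
structure Hinge (M : Type*) [MetricSpace M] where
  /-- the vertex -/
  p : M
  /-- the first endpoint -/
  x : M
  /-- the second endpoint -/
  y : M
  /-- the first side -/
  px : Set M
  /-- the second side -/
  py : Set M
  isSegment_px : IsSegment p x px
  isSegment_py : IsSegment p y py
  p_ne_x : p ≠ x
  p_ne_y : p ≠ y

section Comparison

variable {M : Type*} [MetricSpace M] (κ : ℝ)

/-- `(p', x', y')` is a comparison triple in the model plane for `(p, x, y)`. -/
def IsComparisonTriple (p x y : M) (p' x' y' : ModelPlane κ) : Prop :=
  dist p' x' = dist p x ∧ dist p' y' = dist p y ∧ dist x' y' = dist x y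

open Classical in
/-- The comparison angle `∠^κ_p(x, y)`: the angle at the first vertex of any comparison triple for
`(p, x, y)` (with the value `0` if there is no comparison triple). -/
def comparisonAngle (p x y : M) : ℝ :=
  if h : ∃ T : ModelPlane κ × ModelPlane κ × ModelPlane κ,
      IsComparisonTriple κ p x y T.1 T.2.1 T.2.2 then
    ModelPlane.angle h.choose.1 h.choose.2.1 h.choose.2.2
  else 0

/-- The (upper) angle of a hinge: the upper limit of the comparison angles `∠^κ_p(u, v)`
as `u ∈ px` and `v ∈ py`, both distinct from `p`, tend to `p`. -/
def Hinge.angle (H : Hinge M) : ℝ :=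
  limsup (fun w : M × M => comparisonAngle κ H.p w.1 w.2)
    (𝓝[(H.px \ {H.p}) ×ˢ (H.py \ {H.p})] (H.p, H.p))

/-- `(p', x', y')` are the vertex and the endpoints of a comparison hinge in the model plane
for the hinge `H`. -/
def Hinge.IsComparisonHinge (H : Hinge M) (p' x' y' : ModelPlane κ) : Prop :=
  dist p' x' = dist H.p H.x ∧ dist p' y' = dist H.p H.y ∧
    ModelPlane.angle p' x' y' = H.angle κ

/-- Angle comparison. -/
def Hinge.AngleComparison (H : Hinge M) : Prop :=
  comparisonAngle κ H.p H.x H.y ≤ H.angle κ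

/-- Hinge comparison. -/
def Hinge.HingeComparison (H : Hinge M) : Prop :=
  ∀ p' x' y' : ModelPlane κ, H.IsComparisonHinge κ p' x' y' → dist H.x H.y ≤ dist x' y'

/-- Distance comparison. -/
def Hinge.DistanceComparison (H : Hinge M) : Prop :=
  ∀ p' x' y' : ModelPlane κ, IsComparisonTriple κ H.p H.x H.y p' x' y' →
    ∀ px' py' : Set (ModelPlane κ), IsSegment p' x' px' → IsSegment p' y' py' →
      ∀ u ∈ H.px, ∀ v ∈ H.py, ∀ u' ∈ px', ∀ v' ∈ py',
        dist H.p u = dist p' u' → dist H.p v = dist p' v' → dist u' v' ≤ dist u v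

variable (M) in
/-- `M` is a space of curvature `≥ κ` in the sense of Alexandrov. -/
def IsCurvatureGE : Prop :=
  ∀ q : M, ∃ U ∈ 𝓝 q,
    (∀ a ∈ U, ∀ b ∈ U, ∃ s : Set M, IsSegment a b s) ∧
    ∀ H : Hinge M, H.p ∈ U → H.x ∈ U → H.y ∈ U →
      (perimeter H.p H.x H.y : EReal) < 2 * modelDiam κ → H.DistanceComparison κ

end Comparison

end Toponogov

end

/-! The heart is angle comparison for all hinges (`compVers_le_one_sub_cos_upperAngle`), proved by
descent on the size `|px| + |py|`. If it fails for a hinge of size `L`, it fails for another of size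
at most `2L/3` whose vertex is at distance at most `2L`. Iterating, the sizes decay geometrically
and the vertices form a Cauchy sequence. By completeness, late hinges lie in a ball where the
curvature hypothesis already gives the comparison, a contradiction.

The descent step is `compVers_le_of_smallHingeComparison`. Assume comparison for nearby hinges of
size at most `2L/3`, and slide the vertex by `L/12` along the longer side. Comparison for the two
small hinges over the traversed piece, together with the fact that adjacent angles add up to at most
`π` (`IsCurvatureGE.upperAngle_add_le`), shows that the third side of the model hinge does not grow
(`exists_moved_hinge`). The endpoints stay fixed, so a failure persists with at least the same
deficit. Each slide loses a definite amount of size: otherwise the model third side would almost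
equal the sum of the two sides, which is at least the distance of the endpoints. After finitely many
slides the size is at most `2L/3`, where failure is excluded.

Alexandrov's lemma (`compVers_add_le_two_iff`) serves twice: locally it yields the bound on adjacent
angles, and globally it turns angle comparison into monotonicity of comparison angles, which is
distance comparison. Angles enter through `1 - cos`, in which the law of cosines is affine. -/

noncomputable section
namespace Toponogov

/-! ### Generalized trigonometric functions, uniform in `κ`. -/

/-- The generalized sine `sn_κ`, the solution of `f'' + κ f = 0`, `f 0 = 0`, `f' 0 = 1`. -/
def sn (κ t : ℝ) : ℝ :=
  if 0 < κ then Real.sin (√κ * t) / √κ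
  else if κ = 0 then t
  else Real.sinh (√(-κ) * t) / √(-κ)

/-- The modified distance function `md_κ`, the primitive of `sn_κ` with `md_κ 0 = 0`. -/
def md (κ t : ℝ) : ℝ :=
  if 0 < κ then (1 - Real.cos (√κ * t)) / κ
  else if κ = 0 then t ^ 2 / 2
  else (1 - Real.cosh (√(-κ) * t)) / κ

/-- `r` is smaller than the diameter of the model plane. -/
def LtDiam (κ r : ℝ) : Prop := 0 < κ → √κ * r < Real.pi

/-- `r` is at most the diameter of the model plane. -/
def LeDiam (κ r : ℝ) : Prop := 0 < κ → √κ * r ≤ Real.pi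

variable {κ : ℝ}

lemma LtDiam.mono {r s : ℝ} (h : LtDiam κ s) (hrs : r ≤ s) : LtDiam κ r := fun hκ =>
  lt_of_le_of_lt (mul_le_mul_of_nonneg_left hrs (Real.sqrt_nonneg κ)) (h hκ)

lemma LtDiam.le {r : ℝ} (h : LtDiam κ r) : LeDiam κ r := fun hκ => (h hκ).le

lemma LeDiam.ltDiam_of_lt {r s : ℝ} (h : LeDiam κ s) (hrs : r < s) : LtDiam κ r := fun hκ =>
  lt_of_lt_of_le (mul_lt_mul_of_pos_left hrs (Real.sqrt_pos.2 hκ)) (h hκ)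

/-- The factor `1 - κ * md κ a` is the generalized cosine. Together with `md_add` and `sn_sq` this
makes the later trigonometry polynomial algebra without a case split on `κ`. -/
lemma sn_add (κ a b : ℝ) :
    sn κ (a + b) = sn κ a * (1 - κ * md κ b) + sn κ b * (1 - κ * md κ a) := by
  unfold sn md
  split_ifs with h h'
  · rw [mul_add, Real.sin_add]
    field_simp
    ring
  · subst h'; ring
  · have : 0 < -κ := by
      rcases lt_trichotomy κ 0 with h1 | h1 | h1
      · linarith
      · exact absurd h1 h'
      · exact absurd h1 h
    have h2 : √(-κ) ≠ 0 := (Real.sqrt_pos.2 this).ne'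
    rw [mul_add, Real.sinh_add]
    field_simp
    ring

lemma md_add (κ a b : ℝ) :
    md κ (a + b) = md κ a + md κ b - κ * md κ a * md κ b + sn κ a * sn κ b := by
  unfold sn md
  split_ifs with h h'
  · have hs : √κ ≠ 0 := (Real.sqrt_pos.2 h).ne'
    have hq : √κ ^ 2 = κ := Real.sq_sqrt h.le
    rw [mul_add, Real.cos_add]
    generalize √κ = k at *
    subst hq
    field_simp
    ring
  · subst h'; ring
  · have : 0 < -κ := by
      rcases lt_trichotomy κ 0 with h1 | h1 | h1
      · linarith
      · exact absurd h1 h'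
      · exact absurd h1 h
    have hs : √(-κ) ≠ 0 := (Real.sqrt_pos.2 this).ne'
    have hq : κ = -√(-κ) ^ 2 := by rw [Real.sq_sqrt this.le]; ring
    rw [mul_add, Real.cosh_add]
    generalize √(-κ) = k at *
    subst hq
    field_simp
    ring

@[simp] lemma sn_zero (κ : ℝ) : sn κ 0 = 0 := by simp [sn]

@[simp] lemma md_zero (κ : ℝ) : md κ 0 = 0 := by simp [md]

@[simp] lemma sn_neg (κ t : ℝ) : sn κ (-t) = -sn κ t := by
  unfold sn; split_ifs <;> simp [neg_div]

@[simp] lemma md_neg (κ t : ℝ) : md κ (-t) = md κ t := by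
  unfold md; split_ifs <;> simp

@[simp] lemma md_abs (κ t : ℝ) : md κ |t| = md κ t := by
  rcases abs_choice t with h | h <;> simp [h]

lemma md_sub (κ a b : ℝ) :
    md κ (a - b) = md κ a + md κ b - κ * md κ a * md κ b - sn κ a * sn κ b := by
  rw [sub_eq_add_neg, md_add]; simp; ring

lemma md_sub_comm (κ a b : ℝ) : md κ (a - b) = md κ (b - a) := by
  rw [← md_neg, neg_sub]

lemma sn_sq (κ a : ℝ) : sn κ a ^ 2 = 2 * md κ a - κ * md κ a ^ 2 := by
  have := md_sub κ a a
  simp at this; linarith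

lemma sn_pos {t : ℝ} (ht : 0 < t) (h : LtDiam κ t) : 0 < sn κ t := by
  unfold sn
  split_ifs with h1 h2
  · have := Real.sqrt_pos.2 h1
    exact div_pos (Real.sin_pos_of_pos_of_lt_pi (by positivity) (h h1)) this
  · exact ht
  · have : 0 < √(-κ) := Real.sqrt_pos.2 (by
      rcases lt_trichotomy κ 0 with h3 | h3 | h3
      · linarith
      · exact absurd h3 h2
      · exact absurd h3 h1)
    exact div_pos (Real.sinh_pos_iff.2 (by positivity)) this

lemma sn_nonneg {t : ℝ} (ht : 0 ≤ t) (h : LeDiam κ t) : 0 ≤ sn κ t := by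
  rcases ht.eq_or_lt with rfl | ht
  · simp
  by_cases h1 : 0 < κ
  · rw [sn, if_pos h1]
    exact div_nonneg (Real.sin_nonneg_of_nonneg_of_le_pi (by positivity) (h h1))
      (Real.sqrt_nonneg _)
  · exact (sn_pos ht fun h2 => absurd h2 h1).le

lemma md_sub_md (κ s g : ℝ) :
    md κ s - md κ g = 2 * (sn κ ((s + g) / 2) * sn κ ((s - g) / 2)) := by
  have h1 := md_add κ ((s + g) / 2) ((s - g) / 2)
  have h2 := md_sub κ ((s + g) / 2) ((s - g) / 2)
  rw [show (s + g) / 2 + (s - g) / 2 = s by ring] at h1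
  rw [show (s + g) / 2 - (s - g) / 2 = g by ring] at h2
  linarith

/-- By `md_sub_md` the difference is twice a product of `sn` at the half sum and the half
difference. Only the half sum has to stay below the diameter; `s` itself may exceed it, as does
happen for the sum of two sides of a triangle. -/
lemma md_lt_md {g s : ℝ} (hg : 0 ≤ g) (hgs : g < s) (h : LtDiam κ ((s + g) / 2)) :
    md κ g < md κ s := by
  have h1 := sn_pos (t := (s + g) / 2) (by linarith) h
  have h2 := sn_pos (t := (s - g) / 2) (by linarith) (h.mono (by linarith))
  nlinarith [md_sub_md κ s g, mul_pos h1 h2]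

lemma md_le_md {g s : ℝ} (hg : 0 ≤ g) (hgs : g ≤ s) (h : LtDiam κ ((s + g) / 2)) :
    md κ g ≤ md κ s := by
  rcases hgs.eq_or_lt with rfl | h1
  · rfl
  · exact (md_lt_md hg h1 h).le

lemma le_of_md_le_md {a b : ℝ} (hb : 0 ≤ b) (ha' : LeDiam κ a)
    (h : md κ a ≤ md κ b) : a ≤ b := by
  by_contra! hab
  exact absurd (md_lt_md hb hab (ha'.ltDiam_of_lt (by linarith))) h.not_gt

lemma eq_of_md_eq_md {a b : ℝ} (ha : 0 ≤ a) (hb : 0 ≤ b) (ha' : LeDiam κ a) (hb' : LeDiam κ b)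
    (h : md κ a = md κ b) : a = b :=
  le_antisymm (le_of_md_le_md hb ha' h.le) (le_of_md_le_md ha hb' h.ge)

lemma continuous_md (κ : ℝ) : Continuous (md κ) := by
  unfold md; split_ifs <;> fun_prop

lemma continuous_sn (κ : ℝ) : Continuous (sn κ) := by
  unfold sn; split_ifs <;> fun_prop

lemma coe_lt_modelDiam_iff {r : ℝ} : (r : EReal) < modelDiam κ ↔ LtDiam κ r := by
  unfold modelDiam LtDiam
  split_ifs with h
  · simp only [EReal.coe_lt_coe_iff, h, true_imp_iff]
    rw [lt_div_iff₀ (Real.sqrt_pos.2 h), mul_comm]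
  · simp [h]

lemma coe_lt_two_mul_modelDiam_iff {r : ℝ} :
    (r : EReal) < 2 * modelDiam κ ↔ LtDiam κ (r / 2) := by
  unfold modelDiam LtDiam
  split_ifs with h
  · rw [show (2 : EReal) = ((2 : ℝ) : EReal) from rfl, ← EReal.coe_mul]
    simp only [EReal.coe_lt_coe_iff, h, true_imp_iff]
    rw [← mul_div_assoc, lt_div_iff₀ (Real.sqrt_pos.2 h)]
    constructor <;> intro <;> linarith
  · rw [EReal.mul_top_of_pos (by norm_num)]
    simp [h]

/-! ### Law of cosines and polar coordinates in the model plane. -/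

namespace ModelPlane

variable {κ : ℝ}

lemma dist_def (x y : ModelPlane κ) : dist x y =
    if 0 < κ then Real.arccos (form x y) / √κ
    else if κ = 0 then ‖x.v - y.v‖
    else Real.arcosh (form x y) / √(-κ) := rfl

lemma form_comm (x y : ModelPlane κ) : form x y = form y x := by
  unfold form; rw [real_inner_comm]; ring

protected lemma dist_comm (x y : ModelPlane κ) : dist x y = dist y x := by
  rw [dist_def, dist_def, form_comm, norm_sub_rev]

lemma abs_form_le_one (h : 0 < κ) (x y : ModelPlane κ) : |form x y| ≤ 1 := by
  have hx := x.eq_one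
  have hy := y.eq_one
  have h1 := abs_real_inner_le_norm x.v y.v
  have h2 : |form x y| ≤ |x.t| * |y.t| + κ * (‖x.v‖ * ‖y.v‖) := by
    unfold form
    refine (abs_add_le _ _).trans ?_
    rw [abs_mul, abs_mul, abs_of_pos h]
    gcongr
  rw [← sq_abs] at hx hy
  nlinarith [sq_nonneg (|x.t| - |y.t|), mul_nonneg h.le (sq_nonneg (‖x.v‖ - ‖y.v‖))]

/-- The reversed Cauchy-Schwarz inequality for vectors on the upper sheet of the hyperboloid. -/
lemma one_le_form (h : κ < 0) (x y : ModelPlane κ) : 1 ≤ form x y := by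
  have hx := x.eq_one
  have hy := y.eq_one
  have px := x.pos h.le
  have py := y.pos h.le
  have h1 := real_inner_le_norm x.v y.v
  have h2 : x.t * y.t + κ * (‖x.v‖ * ‖y.v‖) ≤ form x y := by
    unfold form
    have := mul_le_mul_of_nonpos_left h1 h.le
    linarith
  refine le_trans ?_ h2
  have h3 : 1 - κ * (‖x.v‖ * ‖y.v‖) ≤ x.t * y.t := by
    refine abs_le_of_sq_le_sq' ?_ (by positivity) |>.2
    rw [mul_pow, show x.t ^ 2 = 1 - κ * ‖x.v‖ ^ 2 by linarith,
      show y.t ^ 2 = 1 - κ * ‖y.v‖ ^ 2 by linarith]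
    nlinarith [mul_nonneg (neg_nonneg.2 h.le) (sq_nonneg (‖x.v‖ - ‖y.v‖))]
  linarith

protected lemma dist_nonneg (x y : ModelPlane κ) : 0 ≤ dist x y := by
  rw [dist_def]
  split_ifs with h h'
  · exact div_nonneg (Real.arccos_nonneg _) (Real.sqrt_nonneg _)
  · exact norm_nonneg _
  · exact div_nonneg (Real.arcosh_nonneg (one_le_form (lt_of_le_of_ne (not_lt.1 h) h') x y))
      (Real.sqrt_nonneg _)

lemma leDiam_dist (x y : ModelPlane κ) : LeDiam κ (dist x y) := fun h => by
  rw [dist_def, if_pos h, mul_div_cancel₀ _ (Real.sqrt_pos.2 h).ne']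
  exact Real.arccos_le_pi _

lemma form_eq (x y : ModelPlane κ) : form x y = 1 - κ * md κ (dist x y) := by
  rcases lt_trichotomy κ 0 with h | rfl | h
  · have h1 : √(-κ) ≠ 0 := (Real.sqrt_pos.2 (neg_pos.2 h)).ne'
    rw [dist_def, if_neg h.not_gt, if_neg h.ne, md, if_neg h.not_gt, if_neg h.ne,
      mul_div_cancel₀ _ h1, Real.cosh_arcosh (one_le_form h x y)]
    field_simp [h.ne]
    ring
  · have hx := x.eq_one
    have hy := y.eq_one
    have px := x.pos le_rfl
    have py := y.pos le_rfl
    have : x.t = 1 := by nlinarith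
    have : y.t = 1 := by nlinarith
    simp [form, *]
  · have h1 : √κ ≠ 0 := (Real.sqrt_pos.2 h).ne'
    have h2 := abs_le.1 (abs_form_le_one h x y)
    rw [dist_def, if_pos h, md, if_pos h,
      mul_div_cancel₀ _ h1, Real.cos_arccos h2.1 h2.2]
    field_simp
    ring

lemma t_eq_one (x : ModelPlane 0) : x.t = 1 := by
  have hx := x.eq_one
  have px := x.pos le_rfl
  nlinarith

lemma md_dist_zero (x y : ModelPlane 0) : md 0 (dist x y) = ‖x.v - y.v‖ ^ 2 / 2 := by
  rw [dist_def]; simp [md]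

/-- The law of cosines before any angle is introduced. For `κ ≠ 0` the left side is `(form x y -
form p x * form p y) / κ`, and `form_eq` converts forms to distances; for `κ = 0` it is
polarization. -/
lemma metricForm_dir (p x y : ModelPlane κ) :
    metricForm κ (dir p x) (dir p y) = md κ (dist p x) + md κ (dist p y) - md κ (dist x y)
      - κ * md κ (dist p x) * md κ (dist p y) := by
  by_cases h : κ = 0
  · subst h
    rw [md_dist_zero, md_dist_zero, md_dist_zero]
    have h1 : x.v - y.v = (x.v - p.v) - (y.v - p.v) := by abel
    have h2 := norm_sub_sq_real (x.v - p.v) (y.v - p.v)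
    rw [← h1] at h2
    rw [norm_sub_rev p.v x.v, norm_sub_rev p.v y.v]
    simp only [metricForm, dir, form, t_eq_one]
    simp
    linarith
  · have h1 := form_eq p x
    have h2 := form_eq p y
    have h3 := form_eq x y
    have hp := p.eq_one
    have e : metricForm κ (dir p x) (dir p y) = (form x y - form p x * form p y) / κ := by
      simp only [metricForm, dir, inner_sub_left, inner_sub_right, real_inner_smul_left,
        real_inner_smul_right, real_inner_self_eq_norm_sq]
      have e1 : κ * inner ℝ p.v y.v = form p y - p.t * y.t := by unfold form; ring
      have e2 : κ * inner ℝ x.v p.v = form p x - p.t * x.t := by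
        rw [form_comm]; unfold form; ring
      have e3 : κ * inner ℝ x.v y.v = form x y - x.t * y.t := by unfold form; ring
      field_simp
      linear_combination e3 - form p x * e1 - form p y * e2 + form p x * form p y * hp
    rw [e, h1, h2, h3]
    field_simp
    ring

lemma metricForm_dir_self (p x : ModelPlane κ) :
    metricForm κ (dir p x) (dir p x) = sn κ (dist p x) ^ 2 := by
  rw [metricForm_dir, sn_sq]
  have : md κ (dist x x) = 0 := by
    by_cases h : κ = 0
    · subst h; rw [md_dist_zero]; simp
    · have h1 := form_eq x x
      have h2 := x.eq_one
      rw [form, real_inner_self_eq_norm_sq] at h1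
      have : κ * md κ (dist x x) = 0 := by linarith
      simpa [h] using this
  rw [this]; ring

/-- The tangent space at `p`, as a condition on ambient vectors. -/
def IsTangent (p : ModelPlane κ) (a : ℝ × EuclideanSpace ℝ (Fin 2)) : Prop :=
  a.1 * p.t + κ * inner ℝ a.2 p.v = 0

lemma isTangent_dir (p x : ModelPlane κ) : IsTangent p (dir p x) := by
  have hp := p.eq_one
  simp only [IsTangent, dir, inner_sub_left, real_inner_smul_left, real_inner_self_eq_norm_sq]
  have h : form p x = x.t * p.t + κ * inner ℝ x.v p.v := form_comm p x
  linear_combination -h - form p x * hp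

lemma IsTangent.add_smul {p : ModelPlane κ} {a b : ℝ × EuclideanSpace ℝ (Fin 2)}
    (ha : IsTangent p a) (hb : IsTangent p b) (c : ℝ) : IsTangent p (a + c • b) := by
  simp only [IsTangent, Prod.fst_add, Prod.snd_add, Prod.smul_fst, Prod.smul_snd, smul_eq_mul,
    inner_add_left, real_inner_smul_left] at *
  linear_combination ha + c * hb

/-- For `κ < 0` this says that tangent planes of the hyperboloid are spacelike: tangency expresses
`a.1 * p.t` through an inner product, which Cauchy-Schwarz in `ℝ²` and the equation of `p` bound. -/
lemma IsTangent.metricForm_self_nonneg {p : ModelPlane κ} {a : ℝ × EuclideanSpace ℝ (Fin 2)}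
    (ha : IsTangent p a) : 0 ≤ metricForm κ a a := by
  unfold metricForm
  rw [real_inner_self_eq_norm_sq]
  rcases le_or_gt 0 κ with h | h
  · exact add_nonneg (sq_nonneg _) (div_nonneg (mul_self_nonneg _) h)
  · have hp := p.eq_one
    have hpos := p.pos h.le
    unfold IsTangent at ha
    have h1 : a.1 * p.t = -κ * inner ℝ a.2 p.v := by linarith
    have h2 := real_inner_mul_inner_self_le a.2 p.v
    rw [real_inner_self_eq_norm_sq, real_inner_self_eq_norm_sq] at h2
    have h3 : a.1 ^ 2 * p.t ^ 2 ≤ -κ * ‖a.2‖ ^ 2 * p.t ^ 2 := by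
      calc a.1 ^ 2 * p.t ^ 2 = κ ^ 2 * (inner ℝ a.2 p.v * inner ℝ a.2 p.v) := by
            rw [← mul_pow, h1]; ring
        _ ≤ κ ^ 2 * (‖a.2‖ ^ 2 * ‖p.v‖ ^ 2) := by gcongr
        _ = -κ * ‖a.2‖ ^ 2 * (p.t ^ 2 - 1) := by rw [← hp]; ring
        _ ≤ _ := by
          have : 0 ≤ -κ * ‖a.2‖ ^ 2 := mul_nonneg (by linarith) (sq_nonneg _)
          nlinarith
    have h4 : a.1 ^ 2 ≤ -κ * ‖a.2‖ ^ 2 := le_of_mul_le_mul_right h3 (by positivity)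
    have h5 : -‖a.2‖ ^ 2 ≤ a.1 * a.1 / κ := by
      rw [le_div_iff_of_neg h]; nlinarith
    linarith

lemma metricForm_add_smul_left (κ : ℝ) (a b c : ℝ × EuclideanSpace ℝ (Fin 2)) (r : ℝ) :
    metricForm κ (a + r • b) c = metricForm κ a c + r * metricForm κ b c := by
  simp only [metricForm, Prod.fst_add, Prod.snd_add, Prod.smul_fst, Prod.smul_snd, smul_eq_mul,
    inner_add_left, real_inner_smul_left]
  ring

lemma metricForm_comm (κ : ℝ) (a b : ℝ × EuclideanSpace ℝ (Fin 2)) :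
    metricForm κ a b = metricForm κ b a := by
  unfold metricForm; rw [real_inner_comm]; ring

lemma metricForm_add_smul_self (κ : ℝ) (a b : ℝ × EuclideanSpace ℝ (Fin 2)) (r : ℝ) :
    metricForm κ (a + r • b) (a + r • b) =
      metricForm κ a a + 2 * r * metricForm κ a b + r ^ 2 * metricForm κ b b := by
  rw [metricForm_add_smul_left, metricForm_comm κ a, metricForm_comm κ b,
    metricForm_add_smul_left, metricForm_add_smul_left, metricForm_comm κ b a]
  ring

/-- Cauchy-Schwarz inequality on tangent spaces. -/
lemma IsTangent.metricForm_sq_le {p : ModelPlane κ} {a b : ℝ × EuclideanSpace ℝ (Fin 2)}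
    (ha : IsTangent p a) (hb : IsTangent p b) :
    metricForm κ a b ^ 2 ≤ metricForm κ a a * metricForm κ b b := by
  have h : ∀ r : ℝ, 0 ≤ metricForm κ b b * (r * r) + 2 * metricForm κ a b * r
      + metricForm κ a a := fun r => by
    have := (ha.add_smul hb r).metricForm_self_nonneg
    rw [metricForm_add_smul_self] at this
    linarith
  have := discrim_le_zero h
  unfold discrim at this
  linarith

lemma angle_nonneg (p x y : ModelPlane κ) : 0 ≤ angle p x y := Real.arccos_nonneg _

lemma angle_le_pi (p x y : ModelPlane κ) : angle p x y ≤ Real.pi := Real.arccos_le_pi _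

lemma metricForm_dir_eq_cos (p x y : ModelPlane κ) : metricForm κ (dir p x) (dir p y) =
    sn κ (dist p x) * sn κ (dist p y) * Real.cos (angle p x y) := by
  have h := (isTangent_dir p x).metricForm_sq_le (isTangent_dir p y)
  have hx := sn_nonneg (ModelPlane.dist_nonneg p x) (leDiam_dist p x)
  have hy := sn_nonneg (ModelPlane.dist_nonneg p y) (leDiam_dist p y)
  unfold angle
  rw [metricForm_dir_self, metricForm_dir_self] at *
  rw [Real.sqrt_sq hx, Real.sqrt_sq hy]
  rw [← mul_pow] at h
  have h' := abs_le_of_sq_le_sq' h (by positivity)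
  -- If a side is degenerate or antipodal, the quotient defining the angle has denominator zero, but
  -- Cauchy-Schwarz makes both sides vanish.
  rcases (mul_nonneg hx hy).eq_or_lt with h0 | h0
  · rw [← h0] at h' ⊢
    linarith [h'.1, h'.2]
  · rw [Real.cos_arccos]
    · rw [mul_div_cancel₀ _ h0.ne']
    · rw [le_div_iff₀ h0]; linarith [h'.1]
    · rw [div_le_iff₀ h0]; linarith [h'.2]

/-- Law of cosines in the model plane. -/
lemma md_dist_eq (p x y : ModelPlane κ) : md κ (dist x y) = md κ (dist p x - dist p y) +
    sn κ (dist p x) * sn κ (dist p y) * (1 - Real.cos (angle p x y)) := by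
  have h1 := metricForm_dir p x y
  have h2 := metricForm_dir_eq_cos p x y
  rw [md_sub]
  linarith

/-- If `u` lies on the segment from `p` to `x`, then the tangent vectors `dir p u` and `dir p x`
are parallel, as far as the metric form is concerned. -/
lemma sn_mul_metricForm_dir {p x u : ModelPlane κ}
    (h : dist u x = dist p x - dist p u) (a : ℝ × EuclideanSpace ℝ (Fin 2)) (ha : IsTangent p a) :
    sn κ (dist p x) * metricForm κ (dir p u) a = sn κ (dist p u) * metricForm κ (dir p x) a := by
  rcases eq_or_ne (sn κ (dist p x)) 0 with h0 | h0
  · have := (isTangent_dir p x).metricForm_sq_le ha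
    rw [metricForm_dir_self, h0] at this
    have : metricForm κ (dir p x) a = 0 := by nlinarith
    rw [h0, this]; ring
  set r := -(sn κ (dist p u) / sn κ (dist p x)) with hr
  have h1 := ((isTangent_dir p u).add_smul (isTangent_dir p x) r).metricForm_sq_le ha
  have h2 := metricForm_dir p u x
  have h3 := md_sub κ (dist p x) (dist p u)
  rw [metricForm_add_smul_self, metricForm_dir_self, metricForm_dir_self, h2, h] at h1
  -- The combination `dir p u + r • dir p x` is a null vector, hence orthogonal to every tangent
  -- vector by Cauchy-Schwarz.
  have h4 : sn κ (dist p u) ^ 2 + 2 * r * (md κ (dist p u) + md κ (dist p x)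
      - md κ (dist p x - dist p u) - κ * md κ (dist p u) * md κ (dist p x))
      + r ^ 2 * sn κ (dist p x) ^ 2 = 0 := by
    rw [h3, hr]
    field_simp
    ring
  rw [h4, metricForm_add_smul_left] at h1
  have h5 : metricForm κ (dir p u) a + r * metricForm κ (dir p x) a = 0 := by nlinarith
  rw [hr] at h5
  field_simp at h5
  linarith

/-- Law of cosines for points on the sides of a hinge in the model plane. -/
lemma md_dist_eq_of_mem_sides {p x y u v : ModelPlane κ} (hu : dist u x = dist p x - dist p u)
    (hv : dist v y = dist p y - dist p v) (hx : sn κ (dist p x) ≠ 0) (hy : sn κ (dist p y) ≠ 0) :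
    md κ (dist u v) = md κ (dist p u - dist p v) +
      sn κ (dist p u) * sn κ (dist p v) * (1 - Real.cos (angle p x y)) := by
  have h1 := sn_mul_metricForm_dir hu _ (isTangent_dir p v)
  have h2 := sn_mul_metricForm_dir hv _ (isTangent_dir p x)
  rw [metricForm_comm κ _ (dir p x), metricForm_comm κ _ (dir p x), metricForm_dir_eq_cos p x y]
    at h2
  have h3 : metricForm κ (dir p u) (dir p v) =
      sn κ (dist p u) * sn κ (dist p v) * Real.cos (angle p x y) := by
    apply mul_left_cancel₀ hx
    apply mul_left_cancel₀ hy
    linear_combination sn κ (dist p y) * h1 + sn κ (dist p u) * h2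
  have h4 := metricForm_dir p u v
  rw [md_sub]
  linarith

/-- The point with polar coordinates `(r, φ)`. -/
def polar (κ r φ : ℝ) : ModelPlane κ where
  t := 1 - κ * md κ r
  v := sn κ r • !₂[Real.cos φ, Real.sin φ]
  eq_one := by
    rw [norm_smul, mul_pow, EuclideanSpace.norm_sq_eq]
    simp [sn_sq]
    ring
  pos h := by
    have : 0 ≤ md κ r := by
      rw [← md_abs]
      simpa using md_le_md (κ := κ) le_rfl (abs_nonneg r) fun h' => absurd h' h.not_gt
    nlinarith

lemma md_dist_polar (r s φ ψ : ℝ) : md κ (dist (polar κ r φ) (polar κ s ψ)) =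
    md κ (r - s) + sn κ r * sn κ s * (1 - Real.cos (φ - ψ)) := by
  by_cases h : κ = 0
  · subst h
    rw [md_dist_zero, EuclideanSpace.norm_sq_eq]
    simp [polar, sn, md, Real.cos_sub]
    have h1 := Real.sin_sq_add_cos_sq φ
    have h2 := Real.sin_sq_add_cos_sq ψ
    linear_combination r ^ 2 / 2 * h1 + s ^ 2 / 2 * h2
  · have h1 := form_eq (polar κ r φ) (polar κ s ψ)
    apply mul_left_cancel₀ h
    rw [← sub_eq_zero, ← sub_eq_zero.2 h1, md_sub, Real.cos_sub]
    simp [form, polar, PiLp.inner_apply, inner_smul_left]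
    ring

lemma dist_polar_self {r s φ : ℝ} (hr : LeDiam κ |r - s|) :
    dist (polar κ r φ) (polar κ s φ) = |r - s| := by
  apply eq_of_md_eq_md (ModelPlane.dist_nonneg _ _) (abs_nonneg _) (leDiam_dist _ _) hr
  rw [md_dist_polar, md_abs]; simp

lemma polar_zero (φ ψ : ℝ) : polar κ 0 φ = polar κ 0 ψ := by
  ext i <;> simp [polar]

lemma isSegment_polar {r φ : ℝ} (h0 : 0 ≤ r) (hr : LeDiam κ r) :
    IsSegment (polar κ 0 φ) (polar κ r φ) ((fun s => polar κ s φ) '' Icc 0 r) := by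
  have h : dist (polar κ 0 φ) (polar κ r φ) = r := by
    rw [dist_polar_self] <;> simp [abs_of_nonneg h0, hr]
  refine ⟨fun s => polar κ s φ, rfl, by rw [h], fun a ha b hb => ?_, by rw [h]⟩
  rw [h] at ha hb
  refine dist_polar_self fun hκ => (mul_le_mul_of_nonneg_left ?_ (Real.sqrt_nonneg _)).trans (hr hκ)
  rw [abs_le]; constructor <;> linarith [ha.1, ha.2, hb.1, hb.2]

end ModelPlane

/-! ### Points and subsegments of segments. -/

section Segments

variable {M : Type*} [MetricSpace M] {p q x : M} {s : Set M}

lemma IsSegment.left_mem (h : IsSegment p q s) : p ∈ s := by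
  obtain ⟨γ, h0, -, -, rfl⟩ := h
  exact ⟨0, ⟨le_rfl, dist_nonneg⟩, h0⟩

lemma IsSegment.right_mem (h : IsSegment p q s) : q ∈ s := by
  obtain ⟨γ, -, h1, -, rfl⟩ := h
  exact ⟨_, ⟨dist_nonneg, le_rfl⟩, h1⟩

lemma IsSegment.dist_eq (h : IsSegment p q s) {u v : M} (hu : u ∈ s) (hv : v ∈ s) :
    dist u v = |dist p u - dist p v| := by
  obtain ⟨γ, h0, -, h2, rfl⟩ := h
  obtain ⟨a, ha, rfl⟩ := hu
  obtain ⟨b, hb, rfl⟩ := hv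
  have h3 : ∀ c ∈ Icc 0 (dist p q), dist p (γ c) = c := fun c hc => by
    rw [← h0, h2 0 ⟨le_rfl, dist_nonneg⟩ c hc, zero_sub, abs_neg, abs_of_nonneg hc.1]
  rw [h2 a ha b hb, h3 a ha, h3 b hb]

lemma IsSegment.dist_le (h : IsSegment p q s) {u : M} (hu : u ∈ s) : dist p u ≤ dist p q := by
  obtain ⟨γ, h0, -, h2, rfl⟩ := h
  obtain ⟨a, ha, rfl⟩ := hu
  rw [← h0, h2 0 ⟨le_rfl, dist_nonneg⟩ a ha, zero_sub, abs_neg, abs_of_nonneg ha.1, h0]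
  exact ha.2

lemma IsSegment.dist_right (h : IsSegment p q s) {u : M} (hu : u ∈ s) :
    dist u q = dist p q - dist p u := by
  rw [h.dist_eq hu h.right_mem, abs_sub_comm, abs_of_nonneg (sub_nonneg.2 (h.dist_le hu))]

lemma IsSegment.exists_mem (h : IsSegment p q s) {t : ℝ} (h0 : 0 ≤ t) (ht : t ≤ dist p q) :
    ∃ u ∈ s, dist p u = t := by
  obtain ⟨γ, hγ, -, h2, rfl⟩ := h
  refine ⟨γ t, ⟨t, ⟨h0, ht⟩, rfl⟩, ?_⟩
  rw [← hγ, h2 0 ⟨le_rfl, dist_nonneg⟩ t ⟨h0, ht⟩, zero_sub, abs_neg, abs_of_nonneg h0]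

lemma IsSegment.sub (h : IsSegment p q s) {u v : M} (hu : u ∈ s) (hv : v ∈ s)
    (huv : dist p u ≤ dist p v) :
    IsSegment u v {w ∈ s | dist p u ≤ dist p w ∧ dist p w ≤ dist p v} := by
  have hd : dist u v = dist p v - dist p u := by
    rw [h.dist_eq hu hv, abs_sub_comm, abs_of_nonneg (sub_nonneg.2 huv)]
  have hvq := h.dist_le hv
  obtain ⟨γ, h0, h1, h2, rfl⟩ := h
  have h3 : ∀ c ∈ Icc 0 (dist p q), dist p (γ c) = c := fun c hc => by
    rw [← h0, h2 0 ⟨le_rfl, dist_nonneg⟩ c hc, zero_sub, abs_neg, abs_of_nonneg hc.1]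
  have h4 : ∀ w ∈ γ '' Icc 0 (dist p q), γ (dist p w) = w := by
    rintro _ ⟨c, hc, rfl⟩
    rw [h3 c hc]
  have h5 : ∀ a ∈ Icc 0 (dist u v), a + dist p u ∈ Icc 0 (dist p q) := fun a ha => by
    have := dist_nonneg (x := p) (y := u)
    constructor <;> linarith [ha.1, ha.2]
  refine ⟨fun a => γ (a + dist p u), by simp [h4 u hu], by simp [hd, h4 v hv],
    fun a ha b hb => ?_, ?_⟩
  · rw [h2 _ (h5 a ha) _ (h5 b hb)]; congr 1; ring
  · ext w
    constructor
    · rintro ⟨hw, hw1, hw2⟩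
      exact ⟨dist p w - dist p u, ⟨by linarith, by linarith⟩, by simp [h4 w hw]⟩
    · rintro ⟨a, ha, rfl⟩
      refine ⟨⟨_, h5 a ha, rfl⟩, ?_⟩
      simp only [h3 _ (h5 a ha)]
      constructor <;> linarith [ha.1, ha.2]

lemma IsSegment.symm (h : IsSegment p q s) : IsSegment q p s := by
  obtain ⟨γ, h0, h1, h2, rfl⟩ := h
  refine ⟨fun a => γ (dist p q - a), by simp [h1], by simp [dist_comm q p, h0], ?_, ?_⟩
  · intro a ha b hb
    rw [dist_comm q p] at ha hb
    rw [h2 _ ⟨by linarith [ha.2], by linarith [ha.1]⟩ _ ⟨by linarith [hb.2], by linarith [hb.1]⟩,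
      abs_sub_comm]
    congr 1; ring
  · rw [dist_comm q p]
    ext w
    constructor
    · rintro ⟨a, ha, rfl⟩
      exact ⟨dist p q - a, ⟨by linarith [ha.2], by linarith [ha.1]⟩, by simp⟩
    · rintro ⟨a, ha, rfl⟩
      exact ⟨dist p q - a, ⟨by linarith [ha.2], by linarith [ha.1]⟩, rfl⟩

lemma IsSegment.exists_left (h : IsSegment p q s) {u : M} (hu : u ∈ s) :
    ∃ t ⊆ s, IsSegment p u t :=
  ⟨_, fun _ hw => hw.1, h.sub h.left_mem hu (by simp)⟩

lemma IsSegment.exists_right (h : IsSegment p q s) {u : M} (hu : u ∈ s) :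
    ∃ t ⊆ s, IsSegment u q t :=
  ⟨_, fun _ hw => hw.1, h.sub hu h.right_mem (h.dist_le hu)⟩

lemma IsSegment.mem_of_subset {t : Set M} (h : IsSegment p q s) (ht : IsSegment p x t)
    (hts : t ⊆ s) {w : M} (hw : w ∈ s) (hwx : dist p w ≤ dist p x) : w ∈ t := by
  obtain ⟨w', hw', h'⟩ := ht.exists_mem dist_nonneg hwx
  have : dist w w' = 0 := by rw [h.dist_eq hw (hts hw'), h']; simp
  rwa [dist_eq_zero.1 this]

lemma IsSegment.neBot (h : IsSegment p q s) (hpq : p ≠ q) : (𝓝[s \ {p}] p).NeBot := by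
  rw [← mem_closure_iff_nhdsWithin_neBot, Metric.mem_closure_iff]
  intro ε hε
  have hd := dist_pos.2 hpq
  obtain ⟨u, hu, h1⟩ := h.exists_mem (t := min (ε / 2) (dist p q)) (by positivity)
    (min_le_right _ _)
  refine ⟨u, ⟨hu, ?_⟩, ?_⟩
  · rintro rfl
    have : 0 < min (ε / 2) (dist u q) := by positivity
    rw [dist_self] at h1
    linarith
  · rw [h1]
    exact (min_le_left _ _).trans_lt (by linarith)

end Segments

/-! ### Comparison triples and comparison angles. -/

section Comparison

variable {κ : ℝ} {M : Type*} [MetricSpace M] {p q x y : M} {s t : Set M}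

lemma perimeter_swap (p x y : M) : perimeter p y x = perimeter p x y := by
  unfold perimeter; rw [dist_comm y x]; ring

lemma LtDiam.dist_left (h : LtDiam κ (perimeter p x y / 2)) : LtDiam κ (dist p x) :=
  h.mono (by unfold perimeter; linarith [dist_triangle_right p x y])

lemma LtDiam.dist_right (h : LtDiam κ (perimeter p x y / 2)) : LtDiam κ (dist p y) :=
  h.mono (by unfold perimeter; linarith [dist_triangle p x y])

lemma LtDiam.dist_base (h : LtDiam κ (perimeter p x y / 2)) : LtDiam κ (dist x y) :=
  h.mono (by unfold perimeter; linarith [dist_triangle_left x y p])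

/-- The quantity `1 - cos α`, where `α` is the comparison angle at `p` of the triple
`(p, x, y)`. -/
def compVers (κ : ℝ) (p x y : M) : ℝ :=
  (md κ (dist x y) - md κ (dist p x - dist p y)) / (sn κ (dist p x) * sn κ (dist p y))

lemma compVers_comm (κ : ℝ) (p x y : M) : compVers κ p x y = compVers κ p y x := by
  unfold compVers
  rw [dist_comm x y, md_sub_comm, mul_comm (sn κ (dist p x))]

lemma sn_dist_pos (hx : p ≠ x) (h : LtDiam κ (dist p x)) : 0 < sn κ (dist p x) :=
  sn_pos (dist_pos.2 hx) h

lemma md_eq_compVers (hx : p ≠ x) (hy : p ≠ y) (h : LtDiam κ (perimeter p x y / 2)) :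
    md κ (dist x y) = md κ (dist p x - dist p y) +
      sn κ (dist p x) * sn κ (dist p y) * compVers κ p x y := by
  have h1 := sn_dist_pos hx h.dist_left
  have h2 := sn_dist_pos hy h.dist_right
  unfold compVers
  field_simp
  ring

lemma compVers_nonneg (hx : p ≠ x) (hy : p ≠ y) (h : LtDiam κ (perimeter p x y / 2)) :
    0 ≤ compVers κ p x y := by
  have h1 := sn_dist_pos hx h.dist_left
  have h2 := sn_dist_pos hy h.dist_right
  refine div_nonneg (sub_nonneg.2 ?_) (by positivity)
  rw [← md_abs κ (_ - _)]
  have h3 : |dist p x - dist p y| ≤ dist x y := by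
    rw [abs_le]
    constructor <;> linarith [dist_triangle_right p x y, dist_triangle p x y]
  exact md_le_md (abs_nonneg _) h3 (h.dist_base.mono (by linarith))

/-- This is the triangle inequality `|xy| ≤ |px| + |py|` under `md`. The bound on the perimeter is
exactly the half-sum condition of `md_le_md`. -/
lemma compVers_le_two (hx : p ≠ x) (hy : p ≠ y) (h : LtDiam κ (perimeter p x y / 2)) :
    compVers κ p x y ≤ 2 := by
  have h1 := sn_dist_pos hx h.dist_left
  have h2 := sn_dist_pos hy h.dist_right
  unfold compVers
  rw [div_le_iff₀ (by positivity)]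
  have h3 := md_le_md (κ := κ) dist_nonneg (dist_triangle_left x y p) h
  have h4 := md_sub_md κ (dist p x + dist p y) (dist p x - dist p y)
  rw [show (dist p x + dist p y + (dist p x - dist p y)) / 2 = dist p x by ring,
    show (dist p x + dist p y - (dist p x - dist p y)) / 2 = dist p y by ring] at h4
  linarith

lemma isComparisonTriple_polar (hx : p ≠ x) (hy : p ≠ y) (h : LtDiam κ (perimeter p x y / 2)) :
    IsComparisonTriple κ p x y (ModelPlane.polar κ 0 0)
      (ModelPlane.polar κ (dist p x) (Real.arccos (1 - compVers κ p x y)))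
      (ModelPlane.polar κ (dist p y) 0) := by
  have h0 := compVers_nonneg hx hy h
  have h2 := compVers_le_two hx hy h
  refine ⟨?_, ?_, ?_⟩
  · rw [ModelPlane.polar_zero 0 (Real.arccos (1 - compVers κ p x y)),
      ModelPlane.dist_polar_self] <;> simp [h.dist_left.le]
  · rw [ModelPlane.dist_polar_self] <;> simp [h.dist_right.le]
  · apply eq_of_md_eq_md (ModelPlane.dist_nonneg _ _) dist_nonneg (ModelPlane.leDiam_dist _ _)
      h.dist_base.le
    have hc := Real.cos_arccos (x := 1 - compVers κ p x y) (by linarith) (by linarith)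
    rw [ModelPlane.md_dist_polar, sub_zero, hc, md_eq_compVers hx hy h, sub_sub_cancel]

lemma IsComparisonTriple.one_sub_cos_angle {p' x' y' : ModelPlane κ}
    (hT : IsComparisonTriple κ p x y p' x' y')
    (hx : p ≠ x) (hy : p ≠ y) (h : LtDiam κ (perimeter p x y / 2)) :
    1 - Real.cos (ModelPlane.angle p' x' y') = compVers κ p x y := by
  have h1 := (sn_dist_pos hx h.dist_left).ne'
  have h2 := (sn_dist_pos hy h.dist_right).ne'
  have h3 := ModelPlane.md_dist_eq p' x' y'
  obtain ⟨e1, e2, e3⟩ := hT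
  rw [e1, e2, e3, md_eq_compVers hx hy h] at h3
  have h4 := mul_left_cancel₀ (mul_ne_zero h1 h2) (add_left_cancel h3)
  exact h4.symm

lemma one_sub_cos_comparisonAngle (hx : p ≠ x) (hy : p ≠ y)
    (h : LtDiam κ (perimeter p x y / 2)) :
    1 - Real.cos (comparisonAngle κ p x y) = compVers κ p x y := by
  have hT : ∃ T : ModelPlane κ × ModelPlane κ × ModelPlane κ,
      IsComparisonTriple κ p x y T.1 T.2.1 T.2.2 :=
    ⟨(_, _, _), isComparisonTriple_polar hx hy h⟩
  rw [comparisonAngle, dif_pos hT]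
  exact hT.choose_spec.one_sub_cos_angle hx hy h

lemma comparisonAngle_mem_Icc (κ : ℝ) (p x y : M) :
    comparisonAngle κ p x y ∈ Icc 0 Real.pi := by
  unfold comparisonAngle
  split_ifs
  · exact ⟨ModelPlane.angle_nonneg _ _ _, ModelPlane.angle_le_pi _ _ _⟩
  · exact ⟨le_rfl, Real.pi_pos.le⟩

lemma comparisonAngle_eq_arccos (hx : p ≠ x) (hy : p ≠ y)
    (h : LtDiam κ (perimeter p x y / 2)) :
    comparisonAngle κ p x y = Real.arccos (1 - compVers κ p x y) := by
  have h1 := comparisonAngle_mem_Icc κ p x y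
  rw [← one_sub_cos_comparisonAngle hx hy h, sub_sub_cancel, Real.arccos_cos h1.1 h1.2]

lemma perimeter_le_of_mem (hs : IsSegment p x s) (ht : IsSegment p y t) {u v : M} (hu : u ∈ s)
    (hv : v ∈ t) : perimeter p u v ≤ perimeter p x y := by
  unfold perimeter
  linarith [hs.dist_right hu, ht.dist_right hv, dist_triangle4 u x y v, dist_comm v y]

/-- The distance comparison property implies the monotonicity of comparison angles. -/
lemma Hinge.DistanceComparison.compVers_le {H : Hinge M} (hD : H.DistanceComparison κ)
    (h : LtDiam κ (perimeter H.p H.x H.y / 2)) {u v : M} (hu : u ∈ H.px) (hv : v ∈ H.py)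
    (hup : H.p ≠ u) (hvp : H.p ≠ v) : compVers κ H.p H.x H.y ≤ compVers κ H.p u v := by
  have h0 := compVers_nonneg H.p_ne_x H.p_ne_y h
  have h2 := compVers_le_two H.p_ne_x H.p_ne_y h
  have hT := isComparisonTriple_polar H.p_ne_x H.p_ne_y h
  have hux := H.isSegment_px.dist_le hu
  have hvy := H.isSegment_py.dist_le hv
  have h' : LtDiam κ (perimeter H.p u v / 2) :=
    h.mono (by linarith [perimeter_le_of_mem H.isSegment_px H.isSegment_py hu hv])
  set φ := Real.arccos (1 - compVers κ H.p H.x H.y) with hφ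
  -- Radial segments serve as the sides of the comparison triangle, so the points matching `u` and
  -- `v` are explicit.
  have hs1 := ModelPlane.isSegment_polar (φ := φ) dist_nonneg h.dist_left.le
  have hs2 := ModelPlane.isSegment_polar (φ := 0) dist_nonneg h.dist_right.le
  rw [ModelPlane.polar_zero φ 0] at hs1
  have h3 := hD _ _ _ hT _ _ hs1 hs2 u hu v hv _ ⟨dist H.p u, ⟨dist_nonneg, hux⟩, rfl⟩ _
    ⟨dist H.p v, ⟨dist_nonneg, hvy⟩, rfl⟩
    (by
      show _ = dist (ModelPlane.polar κ 0 0) (ModelPlane.polar κ _ φ)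
      rw [ModelPlane.polar_zero 0 φ, ModelPlane.dist_polar_self] <;> simp [h'.dist_left.le])
    (by
      show _ = dist (ModelPlane.polar κ 0 0) (ModelPlane.polar κ _ 0)
      rw [ModelPlane.dist_polar_self] <;> simp [h'.dist_right.le])
  have h4 := md_le_md (κ := κ) (ModelPlane.dist_nonneg _ _) h3 (h'.dist_base.mono (by linarith))
  have h5 := sn_dist_pos hup h'.dist_left
  have h6 := sn_dist_pos hvp h'.dist_right
  rw [ModelPlane.md_dist_polar, sub_zero, hφ, Real.cos_arccos (by linarith) (by linarith),
    md_eq_compVers hup hvp h'] at h4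
  rw [sub_sub_cancel] at h4
  exact le_of_mul_le_mul_left (by linarith) (mul_pos h5 h6)

end Comparison

/-! ### Upper angles between segments. -/

section UpperAngle

variable {κ : ℝ} {M : Type*} [MetricSpace M] {p q x y x' y' : M} {s t s' t' : Set M}

/-- The upper angle at `p` between two sets `s` and `t`. -/
def upperAngle (κ : ℝ) (p : M) (s t : Set M) : ℝ :=
  limsup (fun w : M × M => comparisonAngle κ p w.1 w.2) (𝓝[(s \ {p}) ×ˢ (t \ {p})] (p, p))

lemma isBoundedUnder_comparisonAngle (κ : ℝ) (p : M) (F : Filter (M × M)) :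
    F.IsBoundedUnder (· ≤ ·) fun w : M × M => comparisonAngle κ p w.1 w.2 :=
  isBoundedUnder_of ⟨Real.pi, fun _ => (comparisonAngle_mem_Icc κ p _ _).2⟩

lemma isBoundedUnder_ge_comparisonAngle (κ : ℝ) (p : M) (F : Filter (M × M)) :
    F.IsBoundedUnder (· ≥ ·) fun w : M × M => comparisonAngle κ p w.1 w.2 :=
  isBoundedUnder_of ⟨0, fun _ => (comparisonAngle_mem_Icc κ p _ _).1⟩

lemma neBot_hinge (hs : IsSegment p x s) (ht : IsSegment p y t) (hx : p ≠ x) (hy : p ≠ y) :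
    (𝓝[(s \ {p}) ×ˢ (t \ {p})] (p, p)).NeBot := by
  have := hs.neBot hx
  have := ht.neBot hy
  rw [nhdsWithin_prod_eq]
  infer_instance

lemma upperAngle_mem_Icc (hs : IsSegment p x s) (ht : IsSegment p y t) (hx : p ≠ x)
    (hy : p ≠ y) : upperAngle κ p s t ∈ Icc 0 Real.pi := by
  have := neBot_hinge hs ht hx hy
  constructor
  · exact le_limsup_of_frequently_le
      (Frequently.of_forall fun w => (comparisonAngle_mem_Icc κ p w.1 w.2).1)
      (isBoundedUnder_comparisonAngle κ p _)
  · exact limsup_le_of_le (isBoundedUnder_ge_comparisonAngle κ p _).isCoboundedUnder_flip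
      (Eventually.of_forall fun w => (comparisonAngle_mem_Icc κ p w.1 w.2).2)

lemma eventually_hinge (κ : ℝ) (p : M) (s t : Set M) :
    ∀ᶠ w in 𝓝[(s \ {p}) ×ˢ (t \ {p})] (p, p),
      w.1 ∈ s ∧ w.2 ∈ t ∧ p ≠ w.1 ∧ p ≠ w.2 ∧ LtDiam κ (perimeter p w.1 w.2 / 2) := by
  have h1 : ∀ᶠ w : M × M in 𝓝 (p, p), LtDiam κ (perimeter p w.1 w.2 / 2) := by
    by_cases h : 0 < κ
    · have h2 : Tendsto (fun w : M × M => √κ * (perimeter p w.1 w.2 / 2)) (𝓝 (p, p)) (𝓝 0) := by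
        have : Continuous fun w : M × M => √κ * (perimeter p w.1 w.2 / 2) := by
          unfold perimeter; fun_prop
        simpa [perimeter] using this.tendsto (p, p)
      filter_upwards [h2.eventually_lt_const Real.pi_pos] with w hw _ using hw
    · exact Eventually.of_forall fun w h' => absurd h' h
  filter_upwards [nhdsWithin_le_nhds h1, self_mem_nhdsWithin] with w hw hw'
  exact ⟨hw'.1.1, hw'.2.1, fun h => hw'.1.2 h.symm, fun h => hw'.2.2 h.symm, hw⟩

lemma upperAngle_comm (κ : ℝ) (p : M) (s t : Set M) :
    upperAngle κ p s t = upperAngle κ p t s := by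
  have h1 : 𝓝[(t \ {p}) ×ˢ (s \ {p})] (p, p) =
      map Prod.swap (𝓝[(s \ {p}) ×ˢ (t \ {p})] (p, p)) := by
    rw [nhdsWithin_prod_eq, nhdsWithin_prod_eq, prod_comm]
  unfold upperAngle
  rw [h1]
  refine Eq.trans (limsup_congr ?_) (limsup_comp _ _ _)
  filter_upwards [eventually_hinge κ p s t] with w hw
  obtain ⟨-, -, h2, h3, h4⟩ := hw
  rw [comparisonAngle_eq_arccos h2 h3 h4]
  show _ = comparisonAngle κ p w.2 w.1
  rw [comparisonAngle_eq_arccos h3 h2 (by rwa [perimeter_swap]), compVers_comm]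

/-- The upper angle depends only on the germs of the segments. -/
lemma upperAngle_congr (hs : IsSegment p x s) (ht : IsSegment p y t) (hs' : IsSegment p x' s')
    (ht' : IsSegment p y' t') (hx : p ≠ x') (hy : p ≠ y') (hss : s' ⊆ s) (htt : t' ⊆ t) :
    upperAngle κ p s' t' = upperAngle κ p s t := by
  unfold upperAngle
  congr 1
  rw [nhdsWithin_prod_eq, nhdsWithin_prod_eq]
  have key : ∀ {x x' : M} {s s' : Set M}, IsSegment p x s → IsSegment p x' s' → p ≠ x' →
      s' ⊆ s → 𝓝[s' \ {p}] p = 𝓝[s \ {p}] p := by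
    intro x x' s s' hs hs' hx hss
    refine nhdsWithin_eq_nhdsWithin (Metric.mem_ball_self (dist_pos.2 hx)) Metric.isOpen_ball ?_
    ext w
    constructor
    · rintro ⟨⟨h1, h2⟩, h3⟩
      exact ⟨⟨hss h1, h2⟩, h3⟩
    · rintro ⟨⟨h1, h2⟩, h3⟩
      refine ⟨⟨hs.mem_of_subset hs' hss h1 ?_, h2⟩, h3⟩
      rw [dist_comm p w]
      exact (Metric.mem_ball.1 h3).le
  rw [key hs hs' hx hss, key ht ht' hy htt]

/-- Under the monotonicity `hm` every comparison angle close to the vertex is at least the given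
one, hence so is their upper limit. -/
lemma compVers_le_one_sub_cos (hs : IsSegment p x s) (ht : IsSegment p y t) (hx : p ≠ x)
    (hy : p ≠ y) (h : LtDiam κ (perimeter p x y / 2))
    (hm : ∀ u ∈ s, ∀ v ∈ t, p ≠ u → p ≠ v → compVers κ p x y ≤ compVers κ p u v) :
    compVers κ p x y ≤ 1 - Real.cos (upperAngle κ p s t) := by
  have := neBot_hinge hs ht hx hy
  have h1 : comparisonAngle κ p x y ≤ upperAngle κ p s t := by
    refine le_limsup_of_frequently_le (Eventually.frequently ?_)
      (isBoundedUnder_comparisonAngle κ p _)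
    filter_upwards [eventually_hinge κ p s t] with w hw
    obtain ⟨h1, h2, h3, h4, h5⟩ := hw
    rw [comparisonAngle_eq_arccos hx hy h, comparisonAngle_eq_arccos h3 h4 h5]
    exact Real.arccos_le_arccos (by linarith [hm _ h1 _ h2 h3 h4])
  rw [← one_sub_cos_comparisonAngle hx hy h]
  have := Real.cos_le_cos_of_nonneg_of_le_pi (comparisonAngle_mem_Icc κ p x y).1
    (upperAngle_mem_Icc hs ht hx hy).2 h1
  linarith

lemma exists_lt_comparisonAngle (hs : IsSegment p x s) (ht : IsSegment p y t) (hx : p ≠ x)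
    (hy : p ≠ y) {α : ℝ} (hα : α < upperAngle κ p s t) {ε : ℝ} (hε : 0 < ε) :
    ∃ u ∈ s, ∃ v ∈ t, p ≠ u ∧ p ≠ v ∧ dist p u < ε ∧ dist p v < ε ∧
      α < comparisonAngle κ p u v := by
  have := neBot_hinge hs ht hx hy
  have h1 := frequently_lt_of_lt_limsup
    (isBoundedUnder_ge_comparisonAngle κ p _).isCoboundedUnder_flip hα
  have h2 : ∀ᶠ w in 𝓝[(s \ {p}) ×ˢ (t \ {p})] (p, p), w ∈ Metric.ball p ε ×ˢ Metric.ball p ε :=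
    nhdsWithin_le_nhds (prod_mem_nhds (Metric.ball_mem_nhds p hε) (Metric.ball_mem_nhds p hε))
  obtain ⟨w, hw, hw1, hw2⟩ := (h1.and_eventually (h2.and (eventually_hinge κ p s t))).exists
  refine ⟨w.1, hw2.1, w.2, hw2.2.1, hw2.2.2.1, hw2.2.2.2.1, ?_, ?_, hw⟩
  · rw [dist_comm]; exact hw1.1
  · rw [dist_comm]; exact hw1.2

end UpperAngle

/-! ### Trigonometric identities behind the two geometric lemmas. -/

section Trigonometry

variable {κ : ℝ}

/-- For a point `u` on `px` take `d = |pu|`, `e = |ux|`, `f = |py|`, `g = |xy|`, `h = |uy|`. The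
left side measures how far the comparison angles at `u` are from being supplementary, the right side
compares the two comparison angles at `p`. -/
lemma stewart_identity (κ d e f g h : ℝ) :
    2 * sn κ d * sn κ e * sn κ h - sn κ e * (md κ f - md κ (d - h))
      - sn κ d * (md κ g - md κ (e - h)) =
    sn κ (d + e) * (md κ h - md κ (d - f)) - sn κ d * (md κ g - md κ (d + e - f)) := by
  rw [md_sub κ (d + e) f, md_sub, md_sub, md_sub, md_add, sn_add]
  linear_combination -sn κ e * (1 - κ * md κ f) * sn_sq κ d

lemma md_sub_md_add (κ a e : ℝ) : md κ (a + e) - md κ (a - e) = 2 * (sn κ a * sn κ e) := by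
  rw [md_add, md_sub]; ring

/-- Extend the side `d` of a model triangle with sides `a`, `b`, `d` by the length `e`, past its
common vertex with `b`. Both sides are `sn κ d` times `md κ` of the distance from the new endpoint
to the opposite vertex, computed from either end of `d`. -/
lemma extension_identity (κ a b d e : ℝ) :
    sn κ d * md κ (a - (d + e)) + sn κ (d + e) * (md κ b - md κ (a - d)) =
      sn κ d * md κ (b + e) - sn κ e * (md κ a - md κ (b - d)) := by
  rw [md_sub κ a (d + e), md_sub, md_sub, md_add, md_add, sn_add]
  linear_combination sn κ e * (1 - κ * md κ a) * sn_sq κ d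

end Trigonometry

/-! ### Alexandrov's lemma and adjacent angles. -/

section Local

variable {κ : ℝ} {M : Type*} [MetricSpace M] {p q x y u : M} {s t s₁ s₂ : Set M}

/-- Alexandrov's lemma. -/
lemma compVers_add_le_two_iff (hd : dist p x = dist p u + dist u x) (hpu : p ≠ u) (hux : u ≠ x)
    (huy : u ≠ y) (hpy : p ≠ y) (h : LtDiam κ (perimeter p x y / 2)) :
    compVers κ u p y + compVers κ u x y ≤ 2 ↔ compVers κ p x y ≤ compVers κ p u y := by
  have h1 := sn_dist_pos hpu (h.dist_left.mono (by linarith [dist_nonneg (x := u) (y := x)]))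
  have h2 := sn_dist_pos hux (h.dist_left.mono (by linarith [dist_nonneg (x := p) (y := u)]))
  have h3 := sn_dist_pos huy (h.mono (by
    unfold perimeter
    linarith [dist_triangle_left u y p, dist_triangle u x y]))
  have h4 := sn_dist_pos hpy h.dist_right
  have h5 : 0 < sn κ (dist p x) := sn_pos (by
    linarith [dist_pos.2 hpu, dist_nonneg (x := u) (y := x)]) h.dist_left
  have h6 := stewart_identity κ (dist p u) (dist u x) (dist p y) (dist x y) (dist u y)
  rw [← hd] at h6
  have e1 : compVers κ u p y * (sn κ (dist p u) * sn κ (dist u y)) =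
      md κ (dist p y) - md κ (dist p u - dist u y) := by
    unfold compVers; rw [dist_comm u p]; field_simp
  have e2 : compVers κ u x y * (sn κ (dist u x) * sn κ (dist u y)) =
      md κ (dist x y) - md κ (dist u x - dist u y) := by
    unfold compVers; field_simp
  have e3 : compVers κ p x y * (sn κ (dist p x) * sn κ (dist p y)) =
      md κ (dist x y) - md κ (dist p x - dist p y) := by
    unfold compVers; field_simp
  have e4 : compVers κ p u y * (sn κ (dist p u) * sn κ (dist p y)) =
      md κ (dist u y) - md κ (dist p u - dist p y) := by
    unfold compVers; field_simp
  rw [← e1, ← e2, ← e3, ← e4] at h6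
  have h7 : (2 - (compVers κ u p y + compVers κ u x y)) *
      (sn κ (dist p u) * sn κ (dist u x) * sn κ (dist u y)) =
      (compVers κ p u y - compVers κ p x y) *
      (sn κ (dist p u) * sn κ (dist p x) * sn κ (dist p y)) := by
    linear_combination h6
  have p1 : 0 < sn κ (dist p u) * sn κ (dist u x) * sn κ (dist u y) := by positivity
  have p2 : 0 < sn κ (dist p u) * sn κ (dist p x) * sn κ (dist p y) := by positivity
  constructor
  · intro h
    have : 0 ≤ (compVers κ p u y - compVers κ p x y) *
      (sn κ (dist p u) * sn κ (dist p x) * sn κ (dist p y)) := by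
      rw [← h7]; exact mul_nonneg (by linarith) p1.le
    linarith [nonneg_of_mul_nonneg_left this p2]
  · intro h
    have : 0 ≤ (2 - (compVers κ u p y + compVers κ u x y)) *
      (sn κ (dist p u) * sn κ (dist u x) * sn κ (dist u y)) := by
      rw [h7]; exact mul_nonneg (by linarith) p2.le
    linarith [nonneg_of_mul_nonneg_left this p1]

lemma LtDiam.of_mem_ball {z : M} {r : ℝ} (h : LtDiam κ (3 * r)) (hp : p ∈ Metric.ball z r)
    (hx : x ∈ Metric.ball z r) (hy : y ∈ Metric.ball z r) :
    LtDiam κ (perimeter p x y / 2) := by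
  rw [Metric.mem_ball] at *
  refine h.mono ?_
  unfold perimeter
  linarith [dist_triangle_right p x z, dist_triangle_right p y z, dist_triangle_right x y z]

/-- The radius is also small enough that triples in the ball have half perimeter below the diameter:
each distance is less than `2 * r`. Thus perimeter hypotheses come for free. -/
lemma IsCurvatureGE.exists_ball (hcurv : IsCurvatureGE M κ) (z : M) : ∃ r > 0,
    LtDiam κ (3 * r) ∧
    (∀ a ∈ Metric.ball z r, ∀ b ∈ Metric.ball z r, ∃ s : Set M, IsSegment a b s) ∧
    ∀ ⦃p x y : M⦄ ⦃s t : Set M⦄, p ∈ Metric.ball z r → x ∈ Metric.ball z r →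
      y ∈ Metric.ball z r → IsSegment p x s → IsSegment p y t → p ≠ x → p ≠ y →
      ∀ u ∈ s, ∀ v ∈ t, p ≠ u → p ≠ v → compVers κ p x y ≤ compVers κ p u v := by
  obtain ⟨U, hU, h1, h2⟩ := hcurv z
  obtain ⟨ε, hε, hεU⟩ := Metric.mem_nhds_iff.1 hU
  obtain ⟨δ, hδ, hδκ⟩ : ∃ δ > 0, LtDiam κ (3 * δ) := by
    by_cases h : 0 < κ
    · have := Real.sqrt_pos.2 h
      refine ⟨Real.pi / (6 * √κ), by positivity, fun _ => ?_⟩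
      field_simp
      linarith [Real.pi_pos]
    · exact ⟨1, one_pos, fun h' => absurd h' h⟩
  have hb : Metric.ball z (min ε δ) ⊆ U :=
    (Metric.ball_subset_ball (min_le_left _ _)).trans hεU
  have hκ : LtDiam κ (3 * min ε δ) := hδκ.mono (by linarith [min_le_right ε δ])
  refine ⟨min ε δ, lt_min hε hδ, hκ, fun a ha b hb' => h1 a (hb ha) b (hb hb'), ?_⟩
  intro p x y s t hp hx hy hs ht hpx hpy u hu v hv hpu hpv
  have hper := hκ.of_mem_ball hp hx hy
  exact (h2 ⟨p, x, y, s, t, hs, ht, hpx, hpy⟩ (hb hp) (hb hx) (hb hy)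
    (coe_lt_two_mul_modelDiam_iff.2 hper)).compVers_le hper hu hv hpu hpv

/-- The two angles at an interior point of a segment add up to at most `π`. -/
lemma IsCurvatureGE.upperAngle_add_le (hcurv : IsCurvatureGE M κ) (hs : IsSegment p x s)
    (hu : u ∈ s) (hpu : u ≠ p) (hux : u ≠ x) (h₁ : IsSegment u p s₁) (hss₁ : s₁ ⊆ s)
    (h₂ : IsSegment u x s₂) (hss₂ : s₂ ⊆ s) (ht : IsSegment u y t) (huy : u ≠ y) :
    upperAngle κ u s₁ t + upperAngle κ u s₂ t ≤ Real.pi := by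
  by_contra! hlt
  obtain ⟨r, hr, hκ, hseg, hmono⟩ := hcurv.exists_ball u
  have hball : ∀ {w : M}, dist u w < r → w ∈ Metric.ball u r := fun {w} h => by
    rwa [Metric.mem_ball, dist_comm]
  have huu : u ∈ Metric.ball u r := Metric.mem_ball_self hr
  -- Half the excess over `π`, so that two comparison angles within `δ` of the upper angles still
  -- add up to more than `π`.
  obtain ⟨δ, hδ⟩ : ∃ δ, δ = (upperAngle κ u s₁ t + upperAngle κ u s₂ t - Real.pi) / 2 := ⟨_, rfl⟩
  obtain ⟨u₁, hu₁, v₁, hv₁, hn1, hm1, hd1, he1, ha1⟩ := exists_lt_comparisonAngle (κ := κ) h₁ ht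
    hpu huy (α := upperAngle κ u s₁ t - δ) (by linarith) hr
  obtain ⟨u₂, hu₂, v₂, hv₂, hn2, hm2, hd2, he2, ha2⟩ := exists_lt_comparisonAngle (κ := κ) h₂ ht
    hux huy (α := upperAngle κ u s₂ t - δ) (by linarith) hr
  -- The two upper limits are approximated with different points `v₁`, `v₂` of `t`. By local
  -- monotonicity either may be replaced by the one nearer to `u` without decreasing the comparison
  -- angle.
  have closer : ∀ {x' u' v v' : M} {s' : Set M}, IsSegment u x' s' → u' ∈ s' → v' ∈ t → v ∈ t →
      u ≠ u' → u ≠ v' → u ≠ v → dist u u' < r → dist u v' < r → dist u v ≤ dist u v' →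
      comparisonAngle κ u u' v' ≤ Real.arccos (1 - compVers κ u u' v) := by
    intro x' u' v v' s' hs' hu' hv' hv h1 h2 h3 h4 h5 h6
    rw [comparisonAngle_eq_arccos h1 h2 (hκ.of_mem_ball huu (hball h4) (hball h5))]
    obtain ⟨s'', -, hs''⟩ := hs'.exists_left hu'
    obtain ⟨t'', htt, ht''⟩ := ht.exists_left hv'
    exact Real.arccos_le_arccos (sub_le_sub_left (hmono huu (hball h4) (hball h5) hs'' ht'' h1 h2
      _ hs''.right_mem _ (ht.mem_of_subset ht'' htt hv h6) h1 h3) _)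
  obtain ⟨v, hm, hd, hv1, hv2⟩ : ∃ v, u ≠ v ∧ dist u v < r ∧
      comparisonAngle κ u u₁ v₁ ≤ Real.arccos (1 - compVers κ u u₁ v) ∧
      comparisonAngle κ u u₂ v₂ ≤ Real.arccos (1 - compVers κ u u₂ v) := by
    rcases le_total (dist u v₁) (dist u v₂) with h | h
    · exact ⟨v₁, hm1, he1, closer h₁ hu₁ hv₁ hv₁ hn1 hm1 hm1 hd1 he1 le_rfl,
        closer h₂ hu₂ hv₂ hv₁ hn2 hm2 hm1 hd2 he2 h⟩
    · exact ⟨v₂, hm2, he2, closer h₁ hu₁ hv₁ hv₂ hn1 hm1 hm2 hd1 he1 h,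
        closer h₂ hu₂ hv₂ hv₂ hn2 hm2 hm2 hd2 he2 le_rfl⟩
  have hgt : 2 < compVers κ u u₁ v + compVers κ u u₂ v := by
    by_contra! hle
    have := Real.arccos_le_arccos (x := -(1 - compVers κ u u₁ v)) (y := 1 - compVers κ u u₂ v)
      (by linarith)
    rw [Real.arccos_neg] at this
    linarith
  have hκ' := hκ.of_mem_ball (hball hd1) (hball hd2) (hball hd)
  rcases eq_or_ne u₁ v with rfl | hne
  · have h0 : compVers κ u u₁ u₁ = 0 := by simp [compVers]
    linarith [compVers_le_two hn2 hm (hκ.of_mem_ball huu (hball hd2) (hball hd))]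
  · have k1 := h₁.dist_right hu₁
    have k2 := h₂.dist_right hu₂
    have k3 := hs.dist_right hu
    have k4 := hs.dist_right (hss₂ hu₂)
    rw [dist_comm u₁ p, dist_comm u p] at k1
    have k5 := dist_pos.2 hn1
    have k6 := dist_pos.2 hn2
    have k7 : dist u₁ u₂ = dist u₁ u + dist u u₂ := by
      rw [hs.dist_eq (hss₁ hu₁) (hss₂ hu₂), abs_sub_comm, abs_of_nonneg (by linarith),
        dist_comm u₁ u]
      linarith
    -- The hinge at `u₁` with sides towards `u₂` and `v` contains `u` in its first side;
    -- monotonicity there contradicts `hgt` by Alexandrov's lemma.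
    obtain ⟨t', ht'⟩ := hseg _ (hball hd1) _ (hball hd)
    have hle := hmono (hball hd1) (hball hd2) (hball hd)
      (hs.sub (hss₁ hu₁) (hss₂ hu₂) (by linarith)) ht' (fun h => by
        rw [h, dist_self] at k7; linarith [dist_nonneg (x := u₂) (y := u)]) hne u
      ⟨hu, by linarith, by linarith⟩ v ht'.right_mem hn1.symm hne
    rw [← compVers_add_le_two_iff k7 hn1.symm hn2 hm hne hκ'] at hle
    linarith

lemma IsCurvatureGE.one_sub_cos_add_le (hcurv : IsCurvatureGE M κ) (hs : IsSegment p x s)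
    (hu : u ∈ s) (hpu : u ≠ p) (hux : u ≠ x) (h₁ : IsSegment u p s₁) (hss₁ : s₁ ⊆ s)
    (h₂ : IsSegment u x s₂) (hss₂ : s₂ ⊆ s) (ht : IsSegment u y t) (huy : u ≠ y) :
    (1 - Real.cos (upperAngle κ u s₁ t)) + (1 - Real.cos (upperAngle κ u s₂ t)) ≤ 2 := by
  have h := hcurv.upperAngle_add_le hs hu hpu hux h₁ hss₁ h₂ hss₂ ht huy
  have h1 := upperAngle_mem_Icc (κ := κ) h₁ ht hpu huy
  have h2 := upperAngle_mem_Icc (κ := κ) h₂ ht hux huy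
  have := Real.cos_le_cos_of_nonneg_of_le_pi h1.1 (by linarith [h2.1] :
    Real.pi - upperAngle κ u s₂ t ≤ Real.pi) (by linarith)
  rw [Real.cos_pi_sub] at this
  linarith

end Local

/-! ### Sliding the vertex of a hinge. -/

section Key

variable {κ : ℝ} {M : Type*} [MetricSpace M] {p q x y u : M} {s t : Set M}

/-- The modified length `md_κ c` of the third side `c` of a hinge in the model plane with the same
side lengths and the same angle as the hinge formed by the segments `s` from `x` to `p` and `t`
from `x` to `q`. -/
def hingeMd (κ : ℝ) (x p q : M) (s t : Set M) : ℝ :=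
  md κ (dist x p - dist x q) +
    sn κ (dist x p) * sn κ (dist x q) * (1 - Real.cos (upperAngle κ x s t))

lemma hingeMd_comm (κ : ℝ) (x p q : M) (s t : Set M) :
    hingeMd κ x p q s t = hingeMd κ x q p t s := by
  unfold hingeMd
  rw [md_sub_comm, upperAngle_comm]
  ring

lemma compVers_le_iff (hp : x ≠ p) (hq : x ≠ q) (h : LtDiam κ (perimeter x p q / 2)) :
    compVers κ x p q ≤ 1 - Real.cos (upperAngle κ x s t) ↔
      md κ (dist p q) ≤ hingeMd κ x p q s t := by
  have h1 := mul_pos (sn_dist_pos hp h.dist_left) (sn_dist_pos hq h.dist_right)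
  rw [md_eq_compVers hp hq h, hingeMd, add_le_add_iff_left, mul_le_mul_iff_right₀ h1]

/-- Hinge comparison for small hinges with vertices near `x₀`. -/
def SmallHingeComparison (κ : ℝ) (x₀ : M) (R ℓ : ℝ) : Prop :=
  ∀ ⦃x p q : M⦄ ⦃s t : Set M⦄, dist x₀ x ≤ R → IsSegment x p s → IsSegment x q t →
    x ≠ p → x ≠ q → dist x p + dist x q ≤ ℓ → LtDiam κ (perimeter x p q / 2) →
    compVers κ x p q ≤ 1 - Real.cos (upperAngle κ x s t)

lemma perimeter_rotate (x p q : M) : perimeter q p x = perimeter x p q := by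
  unfold perimeter; rw [dist_comm q p, dist_comm q x, dist_comm p x]; ring

/-- Given a hinge of size greater than `8 d` at `x`, moving the vertex by `d` along the longer side
does not increase the length of the third side of the model hinge. -/
lemma exists_moved_hinge (hcurv : IsCurvatureGE M κ)
    (hseg : ∀ a b : M, LtDiam κ (dist a b) → ∃ s : Set M, IsSegment a b s)
    {x₀ : M} {R d : ℝ} (hd : 0 < d) (hsmall : SmallHingeComparison κ x₀ R (8 * d))
    (hs : IsSegment x p s) (ht : IsSegment x q t) (hxp : x ≠ p) (hxq : x ≠ q)
    (hper : LtDiam κ (perimeter x p q / 2)) (hle : dist x p ≤ dist x q)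
    (hlt : 8 * d < dist x p + dist x q) (hle' : dist x p + dist x q ≤ 12 * d)
    (hR : dist x₀ p + 12 * d ≤ R) (hfail : hingeMd κ x p q s t < md κ (dist p q)) :
    ∃ (x' : M) (s' t' : Set M), IsSegment x' p s' ∧ IsSegment x' q t' ∧ x' ≠ p ∧ x' ≠ q ∧
      LtDiam κ (perimeter x' p q / 2) ∧ dist x' p + dist x' q ≤ dist x p + dist x q ∧
      dist x p + dist x q - (dist x' p + dist x' q) ≤ dist x p + d ∧
      hingeMd κ x' p q s' t' ≤ hingeMd κ x p q s t ∧
      sn κ d * md κ (dist x p + dist x q) ≤ sn κ d * hingeMd κ x p q s t +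
        sn κ (dist x q) * (md κ (dist x p + d) - md κ (dist x p + d -
          (dist x p + dist x q - (dist x' p + dist x' q)))) := by
  obtain ⟨x', hx't, hxx'⟩ := ht.exists_mem (t := d) hd.le (by linarith)
  have hx'q : dist x' q = dist x q - d := by rw [ht.dist_right hx't, hxx']
  have hne : x ≠ x' := dist_pos.1 (by rw [hxx']; exact hd)
  have hne' : x' ≠ q := dist_pos.1 (by rw [hx'q]; linarith)
  have hsa := sn_dist_pos hxp hper.dist_left
  have hse := sn_dist_pos hxq hper.dist_right
  -- If the slide ended at `p`, then `|pq| = |xq| - |xp|`, the least possible third side, and the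
  -- comparison could not fail.
  have hx'p : x' ≠ p := by
    rintro rfl
    refine absurd hfail (not_lt.2 ?_)
    rw [hx'q, hingeMd, hxx', md_sub_comm]
    rw [hxx'] at hsa
    have := mul_nonneg (mul_pos hsa hse).le
      (sub_nonneg.2 (Real.cos_le_one (upperAngle κ x s t)))
    linarith
  have hper1 : LtDiam κ (perimeter x p x' / 2) :=
    hper.mono (by linarith [perimeter_le_of_mem hs ht hs.right_mem hx't])
  have hb : dist x' p ≤ dist x p + d := by
    linarith [dist_triangle x' x p, dist_comm x x']
  have hd1 : dist x₀ x' ≤ R := by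
    linarith [dist_triangle x₀ p x', dist_comm p x']
  have hd2 : dist x₀ x ≤ R := by linarith [dist_triangle x₀ p x, dist_comm p x]
  have hper2 : LtDiam κ (perimeter x' p q / 2) := hper.mono (by unfold perimeter; linarith)
  have hper3 : LtDiam κ (perimeter x' p x / 2) := by rwa [perimeter_rotate]
  obtain ⟨s', hs'⟩ := hseg x' p hper2.dist_left
  obtain ⟨t₁, htt₁, ht₁⟩ := ht.exists_left hx't
  obtain ⟨t₂, htt₂, ht₂⟩ := ht.exists_right hx't
  -- The shorter side is at most `6 * d`, so the hinges at `x` and `x'` over the piece `xx'` have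
  -- sizes at most `7 * d` and `8 * d`.
  have c1 := hsmall hd2 hs ht₁ hxp hne (by linarith) hper1
  rw [upperAngle_congr hs ht hs ht₁ hxp hne subset_rfl htt₁] at c1
  have c2 := hsmall hd1 hs' ht₁.symm hx'p hne.symm (by rw [dist_comm x' x]; linarith) hper3
  have c3 := hcurv.one_sub_cos_add_le ht hx't hne.symm hne' ht₁.symm htt₁ ht₂ htt₂ hs' hx'p
  rw [upperAngle_comm κ x' t₁, upperAngle_comm κ x' t₂] at c3
  have hsb := sn_dist_pos hx'p hper2.dist_left
  have hsf := sn_dist_pos hne' hper2.dist_right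
  have hsd : 0 < sn κ d := hxx' ▸ sn_dist_pos hne hper1.dist_right
  have e1 : compVers κ x p x' * (sn κ (dist x p) * sn κ d) =
      md κ (dist x' p) - md κ (dist x p - d) := by
    unfold compVers; rw [hxx', dist_comm p x']; field_simp
  have e2 : compVers κ x' p x * (sn κ (dist x' p) * sn κ d) =
      md κ (dist x p) - md κ (dist x' p - d) := by
    unfold compVers; rw [dist_comm x' x, hxx', dist_comm p x]; field_simp
  have e3 := extension_identity κ (dist x p) (dist x' p) d (dist x' q)
  have e4 := md_sub_md_add κ (dist x' p) (dist x' q)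
  have e5 := md_sub_md_add κ (dist x p) (dist x q)
  have e6 := md_sub_md_add κ (dist x p) d
  rw [show d + dist x' q = dist x q by linarith, ← e1, ← e2] at e3
  have hM : md κ (dist x p - dist x q) +
      sn κ (dist x p) * sn κ (dist x q) * compVers κ x p x' ≤ hingeMd κ x p q s t := by
    unfold hingeMd; gcongr
  have hM' : hingeMd κ x' p q s' t₂ ≤ md κ (dist x' p - dist x' q) +
      sn κ (dist x' p) * sn κ (dist x' q) * (2 - compVers κ x' p x) := by
    unfold hingeMd
    gcongr _ + _ * ?_
    linarith
  -- Both sides describe one model segment: the comparison triangle of `x`, `x'`, `p` with `xx'`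
  -- extended to length `|xq|`, seen from `x'` with the supplementary angle and from `x`.
  have hNN : md κ (dist x' p - dist x' q) +
      sn κ (dist x' p) * sn κ (dist x' q) * (2 - compVers κ x' p x) =
      md κ (dist x p - dist x q) +
      sn κ (dist x p) * sn κ (dist x q) * compVers κ x p x' := by
    apply mul_left_cancel₀ hsd.ne'
    linear_combination sn κ d * (-e4) - e3
  refine ⟨x', s', t₂, hs', ht₂, hx'p, hne', hper2, by linarith, by
    linarith [dist_nonneg (x := x') (y := p)], by linarith, ?_⟩
  rw [show dist x p + d - (dist x p + dist x q - (dist x' p + dist x' q)) = dist x' p by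
    rw [hx'q]; ring]
  have h1 := mul_le_mul_of_nonneg_left hM hsd.le
  -- The shortfall of this segment from `|xp| + |xq|` is controlled by that of `|x'p|` from `|xp| +
  -- d`, and the latter is exactly the loss of size.
  have h2 : sn κ d * (md κ (dist x p - dist x q) +
      sn κ (dist x p) * sn κ (dist x q) * compVers κ x p x') =
      sn κ d * md κ (dist x p + dist x q) -
        sn κ (dist x q) * (md κ (dist x p + d) - md κ (dist x' p)) := by
    linear_combination sn κ (dist x q) * e1 - sn κ d * e5 + sn κ (dist x q) * e6
  linarith

/-- Uniform continuity of `md` and boundedness of `sn` on `[0, L]` give an `ε` independent of the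
hinge; it becomes the guaranteed loss of size per slide. -/
lemma exists_md_modulus (κ d : ℝ) {L μ : ℝ} (hμ : 0 < μ) :
    ∃ ε > 0, ∀ e ∈ Icc 0 L, ∀ a ∈ Icc 0 L, ∀ δ, 0 ≤ δ → δ < ε → δ ≤ a + d → a + d ≤ L →
      sn κ e * (md κ (a + d) - md κ (a + d - δ)) < μ := by
  obtain ⟨C, hC⟩ := isCompact_Icc.exists_bound_of_continuousOn (s := Icc 0 L)
    (continuous_sn κ).continuousOn
  have huc := isCompact_Icc.uniformContinuousOn_of_continuous (s := Icc 0 L)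
    (continuous_md κ).continuousOn
  rw [Metric.uniformContinuousOn_iff] at huc
  obtain ⟨ε, hε, h⟩ := huc (μ / (|C| + 1)) (by positivity)
  refine ⟨ε, hε, fun e he a ha δ h0 h1 h2 h3 => ?_⟩
  have h4 := h (a + d) ⟨by linarith, h3⟩ (a + d - δ) ⟨by linarith, by linarith⟩ (by
    rw [Real.dist_eq, sub_sub_cancel, abs_of_nonneg h0]; exact h1)
  rw [Real.dist_eq] at h4
  have h5 : |sn κ e| < |C| + 1 := by
    have := hC e he
    rw [Real.norm_eq_abs] at this
    linarith [le_abs_self C]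
  calc _ ≤ |sn κ e| * |md κ (a + d) - md κ (a + d - δ)| := by
        rw [← abs_mul]; exact le_abs_self _
    _ ≤ (|C| + 1) * |md κ (a + d) - md κ (a + d - δ)| := by gcongr
    _ < (|C| + 1) * (μ / (|C| + 1)) := by gcongr
    _ = μ := by field_simp

/-- Hinge comparison for hinges of size `12 d` follows from hinge comparison for hinges of size
at most `8 d`. -/
lemma compVers_le_of_smallHingeComparison (hcurv : IsCurvatureGE M κ)
    (hseg : ∀ a b : M, LtDiam κ (dist a b) → ∃ s : Set M, IsSegment a b s)
    {d : ℝ} (hsmall : SmallHingeComparison κ x (24 * d) (8 * d))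
    (hs : IsSegment x p s) (ht : IsSegment x q t) (hxp : x ≠ p) (hxq : x ≠ q)
    (hper : LtDiam κ (perimeter x p q / 2)) (hsize : dist x p + dist x q = 12 * d) :
    compVers κ x p q ≤ 1 - Real.cos (upperAngle κ x s t) := by
  have hp0 := dist_pos.2 hxp
  have hq0 := dist_pos.2 hxq
  have hd : 0 < d := by linarith
  rw [compVers_le_iff hxp hxq hper]
  by_contra! hfail
  have hsd : 0 < sn κ d := sn_pos hd (hper.mono (by
    unfold perimeter; linarith [dist_nonneg (x := p) (y := q)]))
  obtain ⟨ε, hε, hmod⟩ := exists_md_modulus κ d (L := 24 * d)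
    (mul_pos hsd (sub_pos.2 hfail))
  -- Induction on the number of slides of loss `ε` that the size allows. The alternative states that
  -- no failing hinge over the same endpoints has a model third side as short as the original one.
  have key : ∀ n : ℕ, ∀ (x' p' q' : M) (s' t' : Set M), IsSegment x' p' s' → IsSegment x' q' t' →
      x' ≠ p' → x' ≠ q' → LtDiam κ (perimeter x' p' q' / 2) → dist p' q' = dist p q →
      dist x p' ≤ 12 * d → dist x q' ≤ 12 * d → dist x' p' + dist x' q' ≤ 12 * d →
      dist x' p' + dist x' q' ≤ n * ε →
      md κ (dist p q) ≤ hingeMd κ x' p' q' s' t' ∨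
        hingeMd κ x p q s t < hingeMd κ x' p' q' s' t' := by
    intro n
    induction n with
    | zero =>
      intro x' p' q' s' t' _ _ h1 _ _ _ _ _ _ h2
      have := dist_pos.2 h1
      have := dist_nonneg (x := x') (y := q')
      simp at h2
      linarith
    | succ n ih =>
      intro x' p' q' s' t' hs' ht' hp' hq' hper' hpq hxp' hxq' h12 hn
      rcases le_or_gt (dist x' p' + dist x' q') (8 * d) with h8 | h8
      · left
        rw [← hpq, ← compVers_le_iff hp' hq' hper']
        refine hsmall ?_ hs' ht' hp' hq' h8 hper'
        linarith [dist_triangle x p' x', dist_comm x' p', dist_nonneg (x := x') (y := q')]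
      by_contra! hcon
      obtain ⟨hc1, hc2⟩ := hcon
      wlog hle : dist x' p' ≤ dist x' q' generalizing p' q' s' t'
      · rw [hingeMd_comm] at hc1 hc2
        exact this q' p' t' s' ht' hs' hq' hp' (by rwa [perimeter_swap]) (by rwa [dist_comm])
          hxq' hxp' (by linarith) (by linarith) (by linarith) hc1 hc2 (not_le.1 hle).le
      obtain ⟨x'', s'', t'', hs'', ht'', hp'', hq'', hper'', hsz, hsz', hmd, hN⟩ :=
        exists_moved_hinge hcurv hseg hd hsmall hs' ht' hp' hq' hper' hle h8 h12 (by linarith)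
          (by rwa [hpq])
      have hmono : md κ (dist p q) ≤ md κ (dist x' p' + dist x' q') := by
        rw [← hpq]
        exact md_le_md dist_nonneg (dist_triangle_left _ _ _) hper'
      -- A smaller loss would make the model third side so close to the sum of the sides that the
      -- original deficit `md κ (dist p q) - hingeMd κ x p q s t` could not persist.
      have hε' : ε ≤ dist x' p' + dist x' q' - (dist x'' p' + dist x'' q') := by
        by_contra! hlt
        have := hmod (dist x' q') ⟨dist_nonneg, by linarith [dist_nonneg (x := x') (y := p')]⟩
          (dist x' p') ⟨dist_nonneg, by linarith [dist_nonneg (x := x') (y := q')]⟩ _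
          (by linarith) hlt hsz'
          (by linarith [dist_nonneg (x := x') (y := q')])
        have h1 := mul_le_mul_of_nonneg_left hmono hsd.le
        have h2 := mul_le_mul_of_nonneg_left hc2 hsd.le
        linarith
      push_cast at hn
      rcases ih x'' p' q' s'' t'' hs'' ht'' hp'' hq'' hper'' hpq hxp' hxq' (by linarith)
        (by linarith) with h | h
      · linarith
      · linarith
  obtain ⟨n, hn⟩ := exists_nat_ge ((dist x p + dist x q) / ε)
  rw [div_le_iff₀ hε] at hn
  rcases key n x p q s t hs ht hxp hxq hper rfl (by linarith) (by linarith) hsize.le hn with h | h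
  · linarith
  · linarith

end Key

/-! ### Descent to small hinges, and monotonicity in the large. -/

section Global

variable {κ : ℝ} {M : Type*} [MetricSpace M] {p q x y u v : M} {s t : Set M}

/-- Hinge comparison, expressed in terms of `1 - cos`. -/
lemma compVers_le_one_sub_cos_upperAngle [CompleteSpace M] (hcurv : IsCurvatureGE M κ)
    (hseg : ∀ a b : M, LtDiam κ (dist a b) → ∃ s : Set M, IsSegment a b s)
    (hs : IsSegment x p s) (ht : IsSegment x q t) (hxp : x ≠ p) (hxq : x ≠ q)
    (hper : LtDiam κ (perimeter x p q / 2)) :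
    compVers κ x p q ≤ 1 - Real.cos (upperAngle κ x s t) := by
  by_contra! hfail
  let Bad : Hinge M → Prop := fun H => LtDiam κ (perimeter H.p H.x H.y / 2) ∧
    1 - Real.cos (upperAngle κ H.p H.px H.py) < compVers κ H.p H.x H.y
  let size : Hinge M → ℝ := fun H => dist H.p H.x + dist H.p H.y
  have hstep : ∀ H : {H // Bad H}, ∃ H' : {H // Bad H},
      dist H.1.p H'.1.p ≤ 2 * size H.1 ∧ size H'.1 ≤ 2 / 3 * size H.1 := by
    rintro ⟨H, h1, h2⟩
    -- With `d = size H / 12` the constants `24 * d` and `8 * d` become twice and two thirds of the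
    -- size.
    have h3 : ¬ SmallHingeComparison κ H.p (24 * (size H / 12)) (8 * (size H / 12)) := fun h =>
      absurd h2 (compVers_le_of_smallHingeComparison hcurv hseg h H.isSegment_px H.isSegment_py
        H.p_ne_x H.p_ne_y h1 (by simp only [size]; ring)).not_gt
    unfold SmallHingeComparison at h3
    push Not at h3
    obtain ⟨x', p', q', s', t', h4, h5, h6, h7, h8, h9, h10, h11⟩ := h3
    exact ⟨⟨⟨x', p', q', s', t', h5, h6, h7, h8⟩, h10, h11⟩, by simp only; linarith,
      by simp only [size] at *; linarith⟩
  choose f hf1 hf2 using hstep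
  let H : ℕ → {H // Bad H} := fun n => f^[n] ⟨⟨x, p, q, s, t, hs, ht, hxp, hxq⟩, hper, hfail⟩
  have hH : ∀ n, H (n + 1) = f (H n) := fun n => Function.iterate_succ_apply' f n _
  have hsize : ∀ n, size (H n).1 ≤ size (H 0).1 * (2 / 3) ^ n := by
    intro n
    induction n with
    | zero => simp
    | succ n ih =>
      rw [hH, pow_succ]
      linarith [hf2 (H n)]
  have hcau : CauchySeq fun n => (H n).1.p :=
    cauchySeq_of_le_geometric (2 / 3) (2 * size (H 0).1) (by norm_num) fun n => by
      rw [hH]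
      linarith [hf1 (H n), hsize n]
  obtain ⟨z, hz⟩ := cauchySeq_tendsto_of_complete hcau
  obtain ⟨r, hr, hκ, -, hmono⟩ := hcurv.exists_ball z
  have hsize0 : Tendsto (fun n => size (H 0).1 * (2 / 3 : ℝ) ^ n) atTop (𝓝 0) := by
    simpa using (tendsto_pow_atTop_nhds_zero_of_lt_one (by norm_num : (0 : ℝ) ≤ 2 / 3)
      (by norm_num)).const_mul (size (H 0).1)
  obtain ⟨n, hn1, hn2⟩ := ((hz.eventually (Metric.ball_mem_nhds z (half_pos hr))).and
    (hsize0.eventually_lt_const (half_pos hr))).exists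
  have hn3 := (hsize n).trans_lt hn2
  obtain ⟨⟨H', h1, h2⟩, hH'⟩ : ∃ H', H' = H n := ⟨_, rfl⟩
  rw [← hH'] at hn1 hn3
  change dist H'.p z < r / 2 at hn1
  simp only [size] at hn3
  have hx := dist_nonneg (x := H'.p) (y := H'.x)
  have hy := dist_nonneg (x := H'.p) (y := H'.y)
  refine absurd h2 (compVers_le_one_sub_cos H'.isSegment_px H'.isSegment_py H'.p_ne_x H'.p_ne_y h1
    (hmono ?_ ?_ ?_ H'.isSegment_px H'.isSegment_py H'.p_ne_x H'.p_ne_y)).not_gt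
  · rw [Metric.mem_ball]; linarith
  · rw [Metric.mem_ball]; linarith [dist_triangle_left H'.x z H'.p]
  · rw [Metric.mem_ball]; linarith [dist_triangle_left H'.y z H'.p]

/-- Monotonicity of comparison angles in one of the sides. -/
lemma compVers_le_of_mem_left [CompleteSpace M] (hcurv : IsCurvatureGE M κ)
    (hseg : ∀ a b : M, LtDiam κ (dist a b) → ∃ s : Set M, IsSegment a b s)
    (hs : IsSegment p x s) (hpy : p ≠ y) (hper : LtDiam κ (perimeter p x y / 2))
    (hu : u ∈ s) (hpu : p ≠ u) : compVers κ p x y ≤ compVers κ p u y := by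
  have hd : dist p x = dist p u + dist u x := by linarith [hs.dist_right hu]
  rcases eq_or_ne u x with rfl | hux
  · rfl
  rcases eq_or_ne u y with rfl | huy
  · have h1 : dist x u = dist p x - dist p u := by rw [dist_comm]; linarith
    simp [compVers, h1]
  have hper1 : LtDiam κ (perimeter u p y / 2) := hper.mono (by
    unfold perimeter; linarith [dist_comm u p, dist_triangle u x y])
  have hper2 : LtDiam κ (perimeter u x y / 2) := hper.mono (by
    unfold perimeter; linarith [dist_triangle_left u y p])
  obtain ⟨t, ht⟩ := hseg u y hper1.dist_right
  obtain ⟨s₁, hss₁, hs₁⟩ := hs.exists_left hu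
  obtain ⟨s₂, hss₂, hs₂⟩ := hs.exists_right hu
  -- Alexandrov's lemma moves the claim to `u`, where angle comparison for both hinges and the bound
  -- on adjacent angles finish.
  rw [← compVers_add_le_two_iff hd hpu hux huy hpy hper]
  have h1 := compVers_le_one_sub_cos_upperAngle hcurv hseg hs₁.symm ht hpu.symm huy hper1
  have h2 := compVers_le_one_sub_cos_upperAngle hcurv hseg hs₂ ht hux huy hper2
  linarith [hcurv.one_sub_cos_add_le hs hu hpu.symm hux hs₁.symm hss₁ hs₂ hss₂ ht huy]

/-- The endpoints are moved one at a time; the intermediate triple `(p, u, y)` has no larger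
perimeter. -/
lemma compVers_le_of_mem [CompleteSpace M] (hcurv : IsCurvatureGE M κ)
    (hseg : ∀ a b : M, LtDiam κ (dist a b) → ∃ s : Set M, IsSegment a b s)
    (hs : IsSegment p x s) (ht : IsSegment p y t) (hpy : p ≠ y)
    (hper : LtDiam κ (perimeter p x y / 2)) (hu : u ∈ s) (hv : v ∈ t) (hpu : p ≠ u)
    (hpv : p ≠ v) : compVers κ p x y ≤ compVers κ p u v := by
  refine (compVers_le_of_mem_left hcurv hseg hs hpy hper hu hpu).trans ?_
  rw [compVers_comm κ p u y, compVers_comm κ p u v]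
  refine compVers_le_of_mem_left hcurv hseg ht hpu (hper.mono ?_) hv hpv
  rw [perimeter_swap]
  linarith [perimeter_le_of_mem hs ht hu ht.right_mem]

end Global

/-! ### From `compVers` inequalities to the three comparison properties. -/

lemma ModelPlane.dist_right_of_isSegment {κ : ℝ} {p x u : ModelPlane κ} {s : Set (ModelPlane κ)}
    (h : IsSegment p x s) (hu : u ∈ s) : dist u x = dist p x - dist p u := by
  obtain ⟨γ, h0, h1, h2, rfl⟩ := h
  obtain ⟨a, ha, rfl⟩ := hu
  have e1 := h2 0 ⟨le_rfl, ModelPlane.dist_nonneg _ _⟩ a ha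
  have e2 := h2 a ha _ ⟨ModelPlane.dist_nonneg _ _, le_rfl⟩
  rw [h0, zero_sub, abs_neg, abs_of_nonneg ha.1] at e1
  rw [h1, abs_sub_comm, abs_of_nonneg (sub_nonneg.2 ha.2)] at e2
  rw [e1, e2]

section Hinge

variable {κ : ℝ} {M : Type*} [MetricSpace M] {H : Hinge M}

lemma Hinge.angleComparison_of_compVers_le (hper : LtDiam κ (perimeter H.p H.x H.y / 2))
    (h : compVers κ H.p H.x H.y ≤ 1 - Real.cos (H.angle κ)) : H.AngleComparison κ := by
  -- `Hinge.angle` and `upperAngle` agree by definition.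
  have h1 : H.angle κ ∈ Icc 0 Real.pi :=
    upperAngle_mem_Icc H.isSegment_px H.isSegment_py H.p_ne_x H.p_ne_y
  unfold Hinge.AngleComparison
  rw [comparisonAngle_eq_arccos H.p_ne_x H.p_ne_y hper, ← Real.arccos_cos h1.1 h1.2]
  exact Real.arccos_le_arccos (by linarith)

lemma Hinge.hingeComparison_of_compVers_le (hper : LtDiam κ (perimeter H.p H.x H.y / 2))
    (h : compVers κ H.p H.x H.y ≤ 1 - Real.cos (H.angle κ)) : H.HingeComparison κ := by
  rintro p' x' y' ⟨h1, h2, h3⟩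
  refine le_of_md_le_md (ModelPlane.dist_nonneg _ _) hper.dist_base.le ?_
  rw [ModelPlane.md_dist_eq p' x' y', h1, h2, h3,
    md_eq_compVers H.p_ne_x H.p_ne_y hper]
  have := sn_dist_pos H.p_ne_x hper.dist_left
  have := sn_dist_pos H.p_ne_y hper.dist_right
  gcongr

lemma Hinge.distanceComparison_of_compVers_le (hper : LtDiam κ (perimeter H.p H.x H.y / 2))
    (h : ∀ u ∈ H.px, ∀ v ∈ H.py, H.p ≠ u → H.p ≠ v →
      compVers κ H.p H.x H.y ≤ compVers κ H.p u v) : H.DistanceComparison κ := by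
  intro p' x' y' hT px' py' hpx' hpy' u hu v hv u' hu' v' hv' hpu hpv
  have hx := (sn_dist_pos H.p_ne_x hper.dist_left).ne'
  have hy := (sn_dist_pos H.p_ne_y hper.dist_right).ne'
  have hper' : LtDiam κ (perimeter H.p u v / 2) := hper.mono (by
    linarith [perimeter_le_of_mem H.isSegment_px H.isSegment_py hu hv])
  refine le_of_md_le_md dist_nonneg (ModelPlane.leDiam_dist _ _) ?_
  rw [ModelPlane.md_dist_eq_of_mem_sides (ModelPlane.dist_right_of_isSegment hpx' hu')
    (ModelPlane.dist_right_of_isSegment hpy' hv') (by rwa [hT.1]) (by rwa [hT.2.1]),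
    ← hpu, ← hpv, hT.one_sub_cos_angle H.p_ne_x H.p_ne_y hper]
  -- When `u` or `v` is the vertex, the model distance is determined by the sides alone and equals
  -- the distance in `M`.
  rcases eq_or_ne H.p u with rfl | hu0
  · simp
  rcases eq_or_ne H.p v with rfl | hv0
  · simp [dist_comm]
  rw [md_eq_compVers hu0 hv0 hper']
  have := sn_dist_pos hu0 hper'.dist_left
  have := sn_dist_pos hv0 hper'.dist_right
  gcongr
  exact h u hu v hv hu0 hv0

end Hinge

end Toponogov
end

theorem theorem1 (κ : ℝ) (M : Type*) [MetricSpace M] [CompleteSpace M]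
    (hcurv : Toponogov.IsCurvatureGE M κ)
    (hseg : ∀ a b : M, (dist a b : EReal) < Toponogov.modelDiam κ →
      ∃ s : Set M, Toponogov.IsSegment a b s)
    (H : Toponogov.Hinge M)
    (hper : (Toponogov.perimeter H.p H.x H.y : EReal) < 2 * Toponogov.modelDiam κ) :
    H.AngleComparison κ ∧ H.HingeComparison κ ∧ H.DistanceComparison κ := by
  rw [Toponogov.coe_lt_two_mul_modelDiam_iff] at hper
  have hseg' : ∀ a b : M, Toponogov.LtDiam κ (dist a b) → ∃ s : Set M, Toponogov.IsSegment a b s :=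
    fun a b h => hseg a b (Toponogov.coe_lt_modelDiam_iff.2 h)
  have h := Toponogov.compVers_le_one_sub_cos_upperAngle hcurv hseg' H.isSegment_px H.isSegment_py
    H.p_ne_x H.p_ne_y hper
  exact ⟨Toponogov.Hinge.angleComparison_of_compVers_le hper h,
    Toponogov.Hinge.hingeComparison_of_compVers_le hper h,
    Toponogov.Hinge.distanceComparison_of_compVers_le hper fun u hu v hv =>
      Toponogov.compVers_le_of_mem hcurv hseg' H.isSegment_px H.isSegment_py H.p_ne_y hper hu hv⟩
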